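/- Let $G$ be a discrete group and $H$ a subgroup of $G$. Let $L(G)$ be the group von Neumann algebra of $G$, that is, the von Neumann algebra on $\ell^2(G)$ generated by the left translations $u_g$, $g\in G$, with its canonical faithful normal tracial state $\tau(x)=\langle \delta_e, x\delta_e\rangle$, and let $L(H)\subset L(G)$ be the von Neumann subalgebra generated by $\{u_h : h\in H\}$. Then the inclusion $L(H)\subset L(G)$ is co-amenable if and only if $H$ is co-amenable in $G$. Here $H$ is called co-amenable in $G$ if every continuous affine $G$-action on a compact convex subset of a (Hausdorff) locally convex space which has an $H$-fixed point has a $G$-fixed point. For a von Neumann algebra $N$ with a faithful normal tracial state $\tau$ and a von Neumann subalgebra $B\subset N$, the inclusion $B\subset N$ is called co-amenable if there is a norm one projection of $\langle N,B\rangle$ onto $N$, where $\langle N,B\rangle=(JBJ)'\cap\mathcal{B}(L^2(N,\tau))$ is the basic construction, $L^2(N,\tau)$ is the completion of $N$ for the inner product $\langle x,y\rangle=\tau(x^*y)$, on which $N$ acts by left multiplication, and $J$ is the conjugate-linear isometry of $L^2(N,\tau)$ extending $x\mapsto x^*$. -/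

import Mathlib

open scoped ComplexOrder InnerProductSpace lp

universe u v w

/-! ### Co-amenable subgroups -/

/-- A subgroup `H` of a discrete group `G` is co-amenable in `G` if every continuous affine action
of `G` on a compact convex subset `K` of a (Hausdorff, real) locally convex space which has an
`H`-fixed point has a `G`-fixed point. The locally convex space may live in any universe that is
at least as large as the universe of `G`. -/
def Subgroup.IsCoamenable {G : Type u} [Group G] (H : Subgroup G) : Prop :=
  ∀ (E : Type (max u v)) [AddCommGroup E] [Module ℝ E] [TopologicalSpace E]
    [IsTopologicalAddGroup E] [ContinuousSMul ℝ E] [LocallyConvexSpace ℝ E] [T2Space E]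
    (K : Set E) [MulAction G K],
    Convex ℝ K → IsCompact K →
    (∀ g : G, Continuous fun x : K => g • x) →
    (∀ (g : G) (x y z : K) (a b : ℝ), 0 ≤ a → 0 ≤ b → a + b = 1 →
      (z : E) = a • (x : E) + b • (y : E) →
      ((g • z : K) : E) = a • ((g • x : K) : E) + b • ((g • y : K) : E)) →
    (∃ x : K, ∀ h ∈ H, h • x = x) →
    ∃ x : K, ∀ g : G, g • x = x

namespace VonNeumannAlgebra

variable {K : Type w} [NormedAddCommGroup K] [InnerProductSpace ℂ K] [CompleteSpace K]

/-! ### Generalities on von Neumann algebras -/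

/-- The commutant of `S ∪ S*`, for a set `S` of bounded operators. -/
noncomputable def commutantOf (S : Set (K →L[ℂ] K)) : VonNeumannAlgebra K where
  toStarSubalgebra := StarSubalgebra.centralizer ℂ S
  centralizer_centralizer' := by
    change Set.centralizer (Set.centralizer (Set.centralizer (S ∪ star S))) =
      Set.centralizer (S ∪ star S)
    exact Set.centralizer_centralizer_centralizer _

/-- The von Neumann algebra generated by a set `S` of bounded operators, i.e. `(S ∪ S*)''`. -/
noncomputable def generatedBy (S : Set (K →L[ℂ] K)) : VonNeumannAlgebra K :=
  (commutantOf S).commutant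

theorem mem_commutantOf {S : Set (K →L[ℂ] K)} {z : K →L[ℂ] K} :
    z ∈ commutantOf S ↔ ∀ g ∈ S, g * z = z * g ∧ star g * z = z * star g :=
  StarSubalgebra.mem_centralizer_iff ℂ

theorem mem_generatedBy {S : Set (K →L[ℂ] K)} {z : K →L[ℂ] K} :
    z ∈ generatedBy S ↔ ∀ g ∈ commutantOf S, g * z = z * g :=
  mem_commutant_iff

theorem subset_generatedBy (S : Set (K →L[ℂ] K)) : S ⊆ generatedBy S := by
  intro s hs
  rw [SetLike.mem_coe, mem_generatedBy]
  intro g hg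
  exact ((mem_commutantOf.1 hg) s hs).1.symm

theorem generatedBy_mono {S T : Set (K →L[ℂ] K)} (h : S ⊆ T) : generatedBy S ≤ generatedBy T := by
  intro x hx
  rw [mem_generatedBy] at hx ⊢
  exact fun g hg => hx g (mem_commutantOf.2 fun s hs => mem_commutantOf.1 hg s (h hs))

instance isClosed_toStarSubalgebra (N : VonNeumannAlgebra K) :
    IsClosed (N.toStarSubalgebra : Set (K →L[ℂ] K)) := by
  have h : (N.toStarSubalgebra : Set (K →L[ℂ] K)) =
      Set.centralizer (Set.centralizer (N : Set (K →L[ℂ] K))) := by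
    rw [N.centralizer_centralizer]; rfl
  rw [h]
  exact Set.isClosed_centralizer _

/-- A von Neumann algebra, with the order inherited from the Loewner order on bounded operators,
is a star-ordered ring: its positive elements are the `x* x` with `x` in the algebra. -/
instance starOrderedRing (N : VonNeumannAlgebra K) : StarOrderedRing N.toStarSubalgebra := by
  refine StarOrderedRing.of_nonneg_iff' (fun h z => add_le_add_right h z) fun x => ⟨fun h => ?_, ?_⟩
  · have hpos : (x : K →L[ℂ] K).IsPositive :=
      (ContinuousLinearMap.nonneg_iff_isPositive _).1 (show (0 : K →L[ℂ] K) ≤ x from h)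
    have hsa : IsSelfAdjoint x := Subtype.ext hpos.isSelfAdjoint
    have hr : SpectrumRestricts x ContinuousMap.realToNNReal := by
      rw [SpectrumRestricts.nnreal_iff]
      intro r hr
      refine SpectrumRestricts.nnreal_iff.1 hpos.spectrumRestricts r ?_
      rw [← spectrum.algebraMap_mem_iff ℂ] at hr ⊢
      rwa [StarSubalgebra.spectrum_eq] at hr
    let _ := CStarAlgebra.spectralOrder N.toStarSubalgebra
    have _ := CStarAlgebra.spectralOrderedRing N.toStarSubalgebra
    obtain ⟨s, hs, _, hss⟩ := CFC.exists_sqrt_of_isSelfAdjoint_of_quasispectrumRestricts hsa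
      (by simpa using hr)
    exact ⟨s, by rw [hs.star_eq, hss]⟩
  · rintro ⟨s, rfl⟩
    change (0 : K →L[ℂ] K) ≤ star (s : K →L[ℂ] K) * s
    rw [ContinuousLinearMap.nonneg_iff_isPositive]
    exact ContinuousLinearMap.isPositive_adjoint_comp_self _

/-- A faithful normal tracial state `τ` on a von Neumann algebra `N` acting on `K`. Normality is
expressed as `τ(x) = ∑ₙ ⟨ξₙ, x ξₙ⟩` for some sequence of vectors with `∑ₙ ‖ξₙ‖² < ∞`. -/
structure FaithfulNormalTrace (N : VonNeumannAlgebra K) where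
  /-- the positive linear functional on `N` -/
  toFunctional : N.toStarSubalgebra →ₚ[ℂ] ℂ
  map_one : toFunctional 1 = 1
  map_mul_comm : ∀ x y : N.toStarSubalgebra, toFunctional (x * y) = toFunctional (y * x)
  faithful : ∀ x : N.toStarSubalgebra, toFunctional (star x * x) = 0 → x = 0
  normal : ∃ ξ : ℕ → K, (Summable fun n => ‖ξ n‖ ^ 2) ∧
    ∀ x : N.toStarSubalgebra, HasSum (fun n => ⟪ξ n, (x : K →L[ℂ] K) (ξ n)⟫_ℂ) (toFunctional x)

namespace FaithfulNormalTrace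

variable {N : VonNeumannAlgebra K} (τ : FaithfulNormalTrace N)

/-- The Hilbert space `L²(N, τ)`: the completion of `N` for `⟨x, y⟩ = τ(x* y)`. -/
abbrev L2 : Type w := τ.toFunctional.GNS

/-- The representation of `N` on `L²(N, τ)` by left multiplication. -/
noncomputable abbrev leftRep : N.toStarSubalgebra →⋆ₐ[ℂ] (τ.L2 →L[ℂ] τ.L2) :=
  τ.toFunctional.gnsStarAlgHom

/-- The conjugate-linear isometry `x ↦ x*` of `N` equipped with the inner product of `τ`. -/
noncomputable def preConj : τ.toFunctional.PreGNS →L⋆[ℂ] τ.toFunctional.PreGNS :=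
  LinearMap.mkContinuous
    { toFun := fun x => τ.toFunctional.toPreGNS (star (τ.toFunctional.ofPreGNS x))
      map_add' := by simp
      map_smul' := by simp }
    1 (by
      intro x
      simp [PositiveLinearMap.preGNS_norm_def, τ.map_mul_comm (τ.toFunctional.ofPreGNS x)])

/-- The canonical conjugation `J` of `L²(N, τ)`: the continuous extension of `x ↦ x*`. -/
noncomputable def conj : τ.L2 →L⋆[ℂ] τ.L2 := τ.preConj.completion

/-- The algebra `⟨N, B⟩` of the basic construction for `B ⊆ N, τ`: the commutant of `J B J` in the
bounded operators on `L²(N, τ)`. -/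
noncomputable def basicConstruction (B : VonNeumannAlgebra K) : VonNeumannAlgebra τ.L2 :=
  commutantOf {T | ∃ b : N.toStarSubalgebra, (b : K →L[ℂ] K) ∈ B ∧
    T = τ.conj.comp ((τ.leftRep b).comp τ.conj)}

/-- A von Neumann subalgebra `B ⊆ N` is co-amenable in `N` if there is a norm one projection of
`⟨N, B⟩` onto (the copy on `L²(N, τ)` of) `N`. -/
def IsCoamenable (B : VonNeumannAlgebra K) (_hB : B ≤ N) : Prop :=
  ∃ Ψ : (τ.basicConstruction B).toStarSubalgebra →L[ℂ] (τ.basicConstruction B).toStarSubalgebra,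
    ‖Ψ‖ = 1 ∧ Ψ.comp Ψ = Ψ ∧
      Set.range (fun X => (Ψ X : τ.L2 →L[ℂ] τ.L2)) = Set.range τ.leftRep

end FaithfulNormalTrace

end VonNeumannAlgebra

/-! ### Group von Neumann algebras -/

namespace GroupVonNeumannAlgebra

/-- Composition with a permutation `e`, as an operator on `ℓ²`. -/
noncomputable def compPerm {G : Type u} (e : Equiv.Perm G) : ℓ²(G, ℂ) →L[ℂ] ℓ²(G, ℂ) :=
  LinearMap.mkContinuous
    { toFun := fun f => ⟨fun x => f (e x), memℓp_gen (by
        have h := (lp.memℓp f).summable (by simp)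
        exact (e.summable_iff (f := fun x => ‖f x‖ ^ (2 : ENNReal).toReal)).2 h)⟩
      map_add' := fun _ _ => rfl
      map_smul' := fun _ _ => rfl }
    1 (by
      intro f
      rw [one_mul]
      have h2 : 0 < (2 : ENNReal).toReal := by simp
      rw [lp.norm_eq_tsum_rpow h2, lp.norm_eq_tsum_rpow h2]
      exact le_of_eq (congrArg (· ^ (1 / (2 : ENNReal).toReal))
        (e.tsum_eq fun x => ‖f x‖ ^ (2 : ENNReal).toReal)))

theorem star_compPerm {G : Type u} (e : Equiv.Perm G) :
    star (compPerm e) = compPerm e.symm := by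
  refine ((ContinuousLinearMap.eq_adjoint_iff _ _).2 fun x y => ?_).symm
  rw [lp.inner_eq_tsum, lp.inner_eq_tsum, ← e.tsum_eq]
  change ∑' c, ⟪x (e.symm (e c)), y (e c)⟫_ℂ = ∑' c, ⟪x c, y (e c)⟫_ℂ
  simp

open Classical in
/-- The basis vector `δ_g` of `ℓ²(G)`. -/
noncomputable def delta {G : Type u} (g : G) : ℓ²(G, ℂ) := lp.single 2 g 1

theorem inner_delta {G : Type u} (g : G) (f : ℓ²(G, ℂ)) : ⟪delta g, f⟫_ℂ = f g := by
  classical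
  rw [delta, lp.inner_single_left]
  simp

theorem ext_delta {G : Type u} {x : ℓ²(G, ℂ) →L[ℂ] ℓ²(G, ℂ)} (h : ∀ g, x (delta g) = 0) :
    x = 0 := by
  have h0 : ContinuousLinearMap.adjoint x = 0 := by
    ext f g
    rw [← inner_delta, ContinuousLinearMap.adjoint_inner_right, h]
    simp
  simpa using congrArg ContinuousLinearMap.adjoint h0

variable (G : Type u) [Group G]

variable {G} in
/-- The left regular representation: `(λ(g) f)(x) = f(g⁻¹ x)`. -/
noncomputable def leftReg (g : G) : ℓ²(G, ℂ) →L[ℂ] ℓ²(G, ℂ) := compPerm (Equiv.mulLeft g⁻¹)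

variable {G} in
/-- The right regular representation: `(ρ(g) f)(x) = f(x g)`. -/
noncomputable def rightReg (g : G) : ℓ²(G, ℂ) →L[ℂ] ℓ²(G, ℂ) := compPerm (Equiv.mulRight g)

/-- The group von Neumann algebra `L(G)`, generated on `ℓ²(G)` by the operators `λ(g)`, `g ∈ G`. -/
noncomputable def L : VonNeumannAlgebra ℓ²(G, ℂ) :=
  VonNeumannAlgebra.generatedBy (Set.range leftReg)

variable {G} in
/-- The von Neumann algebra `L(H)` of a subgroup `H` of `G`, in its canonical realization inside
`L(G)`: the von Neumann algebra generated by the operators `λ(h)`, `h ∈ H`. -/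
noncomputable def subgroupL (H : Subgroup G) : VonNeumannAlgebra ℓ²(G, ℂ) :=
  VonNeumannAlgebra.generatedBy (leftReg '' H)

variable {G} in
theorem subgroupL_le (H : Subgroup G) : subgroupL H ≤ L G :=
  VonNeumannAlgebra.generatedBy_mono (Set.image_subset_range _ _)

theorem rightReg_delta (g x : G) : rightReg g (delta x) = delta (x * g⁻¹) := by
  classical
  ext y
  change (delta x) (y * g) = delta (x * g⁻¹) y
  simp only [delta, lp.single_apply, Pi.single_apply, eq_mul_inv_iff_mul_eq]

theorem commute_rightReg {x : ℓ²(G, ℂ) →L[ℂ] ℓ²(G, ℂ)} (hx : x ∈ L G) (g : G) :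
    rightReg g * x = x * rightReg g := by
  refine VonNeumannAlgebra.mem_generatedBy.1 hx _ (VonNeumannAlgebra.mem_commutantOf.2 ?_)
  rintro _ ⟨k, rfl⟩
  refine ⟨?_, ?_⟩
  · ext f y
    change f (k⁻¹ * y * g) = f (k⁻¹ * (y * g))
    rw [mul_assoc]
  · rw [leftReg, star_compPerm]
    ext f y
    change f ((k⁻¹)⁻¹ * y * g) = f ((k⁻¹)⁻¹ * (y * g))
    rw [mul_assoc]

/-- The value of `x ∈ L(G)` at `δ_g` is determined by its value at `δ_1`. -/
theorem apply_delta {x : ℓ²(G, ℂ) →L[ℂ] ℓ²(G, ℂ)} (hx : x ∈ L G) (g : G) :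
    x (delta g) = rightReg g⁻¹ (x (delta 1)) := by
  have h := congrArg (fun T => T (delta 1)) (commute_rightReg G hx g⁻¹)
  simpa [rightReg_delta] using h.symm

theorem inner_mul_delta {x y : ℓ²(G, ℂ) →L[ℂ] ℓ²(G, ℂ)} (hx : x ∈ L G) :
    ⟪delta 1, (x * y) (delta 1)⟫_ℂ = ∑' g : G, x (delta 1) g⁻¹ * y (delta 1) g := by
  change ⟪delta 1, x (y (delta 1))⟫_ℂ = _
  rw [← ContinuousLinearMap.adjoint_inner_left, lp.inner_eq_tsum]
  refine tsum_congr fun g => ?_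
  have h : (ContinuousLinearMap.adjoint x (delta 1)) g = starRingEnd ℂ (x (delta 1) g⁻¹) := by
    rw [← inner_delta, ContinuousLinearMap.adjoint_inner_right, apply_delta G hx,
      ← inner_conj_symm, inner_delta]
    change starRingEnd ℂ (x (delta 1) (1 * g⁻¹)) = _
    rw [one_mul]
  rw [h]
  simp [mul_comm]

/-- The canonical trace `τ(x) = ⟨δ_1, x δ_1⟩` of `L(G)`; thus `τ(∑ c_g λ(g)) = c_1`. -/
noncomputable def trace : VonNeumannAlgebra.FaithfulNormalTrace (L G) where
  toFunctional := PositiveLinearMap.mk₀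
    { toFun := fun x => ⟪delta 1, (x : ℓ²(G, ℂ) →L[ℂ] ℓ²(G, ℂ)) (delta 1)⟫_ℂ
      map_add' := fun x y => by simp
      map_smul' := fun c x => by simp }
    (fun x hx => by
      have h := (ContinuousLinearMap.nonneg_iff_isPositive _).1
        (show (0 : ℓ²(G, ℂ) →L[ℂ] ℓ²(G, ℂ)) ≤ x from hx)
      exact h.inner_nonneg_right _)
  map_one := by
    change ⟪delta (1 : G), delta 1⟫_ℂ = 1
    rw [inner_delta]
    simp [delta]
  map_mul_comm := fun x y => by
    change ⟪delta 1, ((x : ℓ²(G, ℂ) →L[ℂ] ℓ²(G, ℂ)) * y) (delta 1)⟫_ℂ =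
      ⟪delta 1, ((y : ℓ²(G, ℂ) →L[ℂ] ℓ²(G, ℂ)) * x) (delta 1)⟫_ℂ
    rw [inner_mul_delta G x.2, inner_mul_delta G y.2, ← (Equiv.inv G).tsum_eq]
    exact tsum_congr fun g => by simp [mul_comm]
  faithful := fun x hx => by
    have h1 : (x : ℓ²(G, ℂ) →L[ℂ] ℓ²(G, ℂ)) (delta 1) = 0 := by
      change ⟪delta 1, ContinuousLinearMap.adjoint (x : ℓ²(G, ℂ) →L[ℂ] ℓ²(G, ℂ))
        ((x : ℓ²(G, ℂ) →L[ℂ] ℓ²(G, ℂ)) (delta 1))⟫_ℂ = 0 at hx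
      rwa [ContinuousLinearMap.adjoint_inner_right, inner_self_eq_zero] at hx
    exact Subtype.ext (ext_delta fun g => by rw [apply_delta G x.2, h1, map_zero])
  normal := by
    refine ⟨fun n => if n = 0 then delta 1 else 0, ?_, fun x => ?_⟩
    · exact summable_of_ne_finset_zero (s := {0}) fun n hn => by
        simp [show n ≠ 0 by simpa using hn]
    · convert hasSum_ite_eq (0 : ℕ) (⟪delta 1, (x : ℓ²(G, ℂ) →L[ℂ] ℓ²(G, ℂ)) (delta 1)⟫_ℂ)
        using 2 with n
      · by_cases hn : n = 0 <;> simp [hn]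
      · rfl

end GroupVonNeumannAlgebra

/-!
The space `L²(L(G), τ)` is `ℓ²(G)`, on which `J λ(g) J` is the right translation by `g`
(`exists_l2Equiv`). Hence the operators of the basic construction commute with the right translations
by `H`, and `L(G)` is the commutant of all right translations (`mem_range_pi`).

If `H` is co-amenable, consider the contractions from the basic construction to all bounded
operators which fix `L(G)`. Conjugation with the right translations defines an affine action of `G`
on this set, which is compact and convex in the topology of pointwise convergence of matrix
coefficients. The inclusion map is a fixed point for `H`, so there is a fixed point for `G`; it
takes values in `L(G)` and is the required projection (`exists_contraction`,
`exists_norm_one_projection`).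

Conversely, let `Ψ` be a norm one projection of the basic construction onto `L(G)`. The basic
construction contains the multiplications by bounded functions on `G/H`, and `τ ∘ Ψ` defines a mean
on these functions (`exists_isInvariantMean`). Invariance of this mean would follow from Tomiyama's
theorem, that `Ψ` is `L(G)`-bimodular. A weaker property suffices: `Ψ` is a map of Jordan modules
(`map_mul_add_mul_of_mem`), because for self-adjoint `a` in `L(G)` the entire function
`t ↦ exp (-t a) Ψ(exp (t a) x exp (t a)) exp (-t a)` is bounded, hence constant by Liouville's
theorem. Therefore the values of `τ ∘ Ψ` at `λ(g)ⁿ x λ(g)⁻ⁿ` form a bounded arithmetic progression,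
and such a progression is constant (`apply_map_conj`). Finally, given an affine action of `G` on a
compact convex set and a point fixed by `H`, the barycenter of the image of the mean under the orbit
map is fixed by `G` (`IsInvariantMean.isCoamenable`).
-/

/-! ### Unital contractions and norm one projections of C⋆-algebras -/

namespace CStarAlgebra

variable {A : Type*} [CStarAlgebra A]

/-- A unital contraction preserves self-adjointness. -/
theorem isSelfAdjoint_map_of_norm_le_one {E : A →L[ℂ] A} (hE : ‖E‖ ≤ 1) (h1 : E 1 = 1) {x : A}
    (hx : IsSelfAdjoint x) : IsSelfAdjoint (E x) := by
  rcases subsingleton_or_nontrivial A with _ | _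
  · exact Subsingleton.elim _ _
  set c : selfAdjoint A := imaginaryPart (E x) with hc
  -- Translating `x` by `i s` costs only `s ^ 2` in the square of the norm.
  have key (s : ℝ) : ‖(c : A) + algebraMap ℝ A s‖ ^ 2 ≤ ‖x‖ ^ 2 + s ^ 2 := by
    have e1 : (c : A) + algebraMap ℝ A s =
        imaginaryPart (E (x + (Complex.I * s) • (1 : A))) := by
      have : imaginaryPart ((Complex.I * s) • (1 : A)) = s • (1 : selfAdjoint A) := by
        rw [mul_smul, imaginaryPart_I_smul]
        ext
        simp
      rw [map_add, map_smul, h1, map_add, this]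
      simp [hc, Algebra.algebraMap_eq_smul_one]
    have e2 : ‖(c : A) + algebraMap ℝ A s‖ ≤ ‖x + (Complex.I * s) • (1 : A)‖ := by
      rw [e1]
      exact (imaginaryPart.norm_le _).trans ((E.le_of_opNorm_le hE _).trans (by simp))
    have e3 : ‖x + (Complex.I * s) • (1 : A)‖ ^ 2 ≤ ‖x‖ ^ 2 + s ^ 2 := by
      have : star (x + (Complex.I * s) • (1 : A)) * (x + (Complex.I * s) • (1 : A)) =
          x * x + ((s : ℂ) ^ 2) • (1 : A) := by
        simp only [star_add, hx.star_eq, star_smul, star_one, add_mul, mul_add, smul_mul_assoc,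
          mul_smul_comm, one_mul, mul_one]
        simp only [RCLike.star_def, map_mul, Complex.conj_I, Complex.conj_ofReal]
        have : -Complex.I * (s : ℂ) * (Complex.I * s) = (s : ℂ) ^ 2 := by
          linear_combination -(s : ℂ) ^ 2 * Complex.I_mul_I
        rw [smul_add, smul_smul, mul_comm (Complex.I * (s : ℂ)) (-Complex.I * s), this]
        module
      rw [sq, ← CStarRing.norm_star_mul_self, this]
      refine (norm_add_le _ _).trans ?_
      rw [norm_smul]
      simp only [norm_pow, Complex.norm_real, Real.norm_eq_abs, sq_abs, CStarRing.norm_one, mul_one]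
      gcongr
      exact (norm_mul_le _ _).trans (sq _).ge
    exact (pow_le_pow_left₀ (norm_nonneg _) e2 2).trans e3
  have hspec (r : ℝ) (hr : r ∈ spectrum ℝ (c : A)) : r = 0 := by
    have h2 (s : ℝ) : (r + s) ^ 2 ≤ ‖x‖ ^ 2 + s ^ 2 := by
      have h3 : r + s ∈ spectrum ℝ ((c : A) + algebraMap ℝ A s) := by
        rw [add_comm (c : A)]
        exact spectrum.add_mem_add_iff.2 hr
      have h4 := spectrum.norm_le_norm_of_mem h3
      rw [← sq_abs]
      exact (pow_le_pow_left₀ (abs_nonneg _) h4 2).trans (key s)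
    by_contra hr0
    have h5 := h2 ((‖x‖ ^ 2 + 1) / (2 * r))
    have : r * ((‖x‖ ^ 2 + 1) / (2 * r)) = (‖x‖ ^ 2 + 1) / 2 := by field_simp
    nlinarith [sq_nonneg r]
  have hc0 : (c : A) = 0 := by
    rcases norm_or_neg_norm_mem_spectrum c.2 with h | h
    · exact norm_eq_zero.1 (hspec _ h)
    · exact norm_eq_zero.1 (neg_eq_zero.1 (hspec _ h))
  exact imaginaryPart_eq_zero_iff.1 (Subtype.ext hc0)

variable [PartialOrder A] [StarOrderedRing A]

/-- A unital contraction is positive. -/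
theorem map_nonneg_of_norm_le_one {E : A →L[ℂ] A} (hE : ‖E‖ ≤ 1) (h1 : E 1 = 1) {x : A}
    (hx : 0 ≤ x) : 0 ≤ E x := by
  have hsa := isSelfAdjoint_map_of_norm_le_one hE h1 (IsSelfAdjoint.of_nonneg hx)
  have hmap (r : ℝ) : E (algebraMap ℝ A r) = algebraMap ℝ A r := by
    rw [Algebra.algebraMap_eq_smul_one, ← Complex.coe_smul, map_smul, h1]
  have h2 : ‖algebraMap ℝ A ‖x‖ - x‖ ≤ ‖x‖ := by
    refine (norm_le_iff_le_algebraMap _ (norm_nonneg _) ?_).2 (sub_le_self _ hx)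
    exact sub_nonneg.2 (IsSelfAdjoint.of_nonneg hx).le_algebraMap_norm_self
  have h3 : ‖algebraMap ℝ A ‖x‖ - E x‖ ≤ ‖x‖ := by
    rw [← hmap, ← map_sub]
    exact (E.le_of_opNorm_le hE _).trans (by simpa using h2)
  have h4 : algebraMap ℝ A ‖x‖ - E x ≤ algebraMap ℝ A ‖x‖ :=
    (((IsSelfAdjoint.algebraMap A (IsSelfAdjoint.all _)).sub hsa).le_algebraMap_norm_self).trans
      (algebraMap_mono A h3)
  simpa using h4

theorem norm_le_of_neg_algebraMap_le {y : A} (hy : IsSelfAdjoint y) {r : ℝ}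
    (hr : 0 ≤ r) (h1 : -algebraMap ℝ A r ≤ y) (h2 : y ≤ algebraMap ℝ A r) : ‖y‖ ≤ r := by
  rcases subsingleton_or_nontrivial A with _ | _
  · simpa [Subsingleton.elim y 0] using hr
  have h1' : algebraMap ℝ A (-r) ≤ y := by simpa using h1
  rcases norm_or_neg_norm_mem_spectrum hy with h | h
  · exact (le_algebraMap_iff_spectrum_le).1 h2 _ h
  · linarith [(algebraMap_le_iff_le_spectrum).1 h1' _ h]

open NormedSpace in
/-- Let `E` be a unital contraction, `a` self-adjoint, `t` real, and suppose that `E` fixes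
`exp (2 t a)`. Then the map
`x ↦ exp (-t a) E (exp (t a) x exp (t a)) exp (-t a)` is positive and unital, hence
contractive on self-adjoint elements. -/
theorem norm_exp_conj_map_le {E : A →L[ℂ] A} (hE : ‖E‖ ≤ 1) (h1 : E 1 = 1) {a : A}
    (ha : IsSelfAdjoint a) (t : ℝ) (hfix : E (exp ((2 * t) • a)) = exp ((2 * t) • a)) {x : A}
    (hx : IsSelfAdjoint x) :
    ‖exp (-(t • a)) * E (exp (t • a) * x * exp (t • a)) * exp (-(t • a))‖ ≤ ‖x‖ := by
  have hinv : exp (-(t • a)) * exp (t • a) = 1 := by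
    let _ := NormedAlgebra.restrictScalars ℚ ℂ A
    rw [← exp_add_of_commute (Commute.neg_left (Commute.refl _)), neg_add_cancel, exp_zero]
  have hinv' : exp (t • a) * exp (-(t • a)) = 1 := by
    let _ := NormedAlgebra.restrictScalars ℚ ℂ A
    rw [← exp_add_of_commute (Commute.neg_right (Commute.refl _)), add_neg_cancel, exp_zero]
  have hsq : exp ((2 * t) • a) = exp (t • a) * exp (t • a) := by
    let _ := NormedAlgebra.restrictScalars ℚ ℂ A
    rw [← exp_add_of_commute (Commute.refl _), ← two_smul ℝ, smul_smul]
  have hta : IsSelfAdjoint (t • a) := (IsSelfAdjoint.all t).smul ha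
  have hp : IsSelfAdjoint (exp (t • a)) := hta.exp
  have hm : IsSelfAdjoint (exp (-(t • a))) := hta.neg.exp
  have hmono {y z : A} (h : y ≤ z) :
      exp (-(t • a)) * E (exp (t • a) * y * exp (t • a)) * exp (-(t • a)) ≤
        exp (-(t • a)) * E (exp (t • a) * z * exp (t • a)) * exp (-(t • a)) := by
    refine hm.conjugate_le_conjugate ?_
    rw [← sub_nonneg, ← map_sub]
    exact map_nonneg_of_norm_le_one hE h1 (sub_nonneg.2 (hp.conjugate_le_conjugate h))
  have halg (r : ℝ) : exp (-(t • a)) * E (exp (t • a) * algebraMap ℝ A r * exp (t • a)) *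
      exp (-(t • a)) = algebraMap ℝ A r := by
    have : exp (t • a) * algebraMap ℝ A r * exp (t • a) = (r : ℂ) • exp ((2 * t) • a) := by
      rw [hsq, Algebra.algebraMap_eq_smul_one, Complex.coe_smul]
      simp
    rw [this, map_smul, hfix, hsq, mul_smul_comm, smul_mul_assoc, ← mul_assoc, hinv, one_mul,
      hinv', Complex.coe_smul, Algebra.algebraMap_eq_smul_one]
  refine norm_le_of_neg_algebraMap_le ?_ (norm_nonneg _) ?_ ?_
  · have h2 : IsSelfAdjoint (exp (t • a) * x * exp (t • a)) := by
      simpa [hp.star_eq] using hx.conjugate (exp (t • a))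
    simpa [hm.star_eq] using (isSelfAdjoint_map_of_norm_le_one hE h1 h2).conjugate (exp (-(t • a)))
  · rw [← map_neg, ← halg]
    exact hmono (by simpa using hx.neg_algebraMap_norm_le_self)
  · rw [← halg]
    exact hmono hx.le_algebraMap_norm_self

open NormedSpace in
/-- A unital contraction `E` which fixes the exponentials of the complex multiples of a self-adjoint
element `a` commutes with conjugation by these exponentials. Indeed
`t ↦ exp (-t a) E (exp (t a) x exp (t a)) exp (-t a)` is an entire function; it is bounded, by
positivity in the real direction and by unitarity of `exp (i s a)` in the imaginary one, so that
Liouville's theorem applies. -/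
theorem map_exp_mul_mul_exp {E : A →L[ℂ] A} (hE : ‖E‖ ≤ 1) {a : A} (ha : IsSelfAdjoint a)
    (hfix : ∀ t : ℂ, E (exp (t • a)) = exp (t • a)) (x : A) (t : ℂ) :
    exp (-(t • a)) * E (exp (t • a) * x * exp (t • a)) * exp (-(t • a)) = E x := by
  have h1 : E 1 = 1 := by simpa using hfix 0
  let F : ℂ → A := fun t =>
    exp (-(t • a)) * E (exp (t • a) * x * exp (t • a)) * exp (-(t • a))
  have hexp : Differentiable ℂ fun t : ℂ => exp (t • a) := fun t =>
    (hasDerivAt_exp_smul_const a t).differentiableAt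
  have hexp' : Differentiable ℂ fun t : ℂ => exp (-(t • a)) := fun t => by
    have := (hasDerivAt_exp_smul_const (-a) t).differentiableAt
    simpa using this
  have hF : Differentiable ℂ F :=
    (hexp'.mul (E.differentiable.comp ((hexp.mul_const x).mul hexp))).mul hexp'
  have hbound (t : ℂ) : ‖F t‖ ≤ 2 * ‖x‖ := by
    let _ := NormedAlgebra.restrictScalars ℚ ℂ A
    have hta : t • a = t.re • a + t.im • (Complex.I • a) := by
      conv_lhs => rw [← Complex.re_add_im t]
      rw [add_smul, mul_smul, Complex.coe_smul, Complex.coe_smul]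
    have hcomm : Commute (t.re • a) (t.im • (Complex.I • a)) :=
      (((Commute.refl a).smul_right Complex.I).smul_right _).smul_left _
    set u : A := exp (t.im • (Complex.I • a)) with hu
    set v : A := exp (-(t.im • (Complex.I • a))) with hv
    have hskew : t.im • (Complex.I • a) ∈ skewAdjoint A := by
      rw [skewAdjoint.mem_iff]
      simp [ha.star_eq]
    have huU : u ∈ unitary A := exp_mem_unitary_of_mem_skewAdjoint hskew
    have hvU : v ∈ unitary A := exp_mem_unitary_of_mem_skewAdjoint (neg_mem hskew)
    have e1 : exp (t • a) = exp (t.re • a) * u := by rw [hta, exp_add_of_commute hcomm]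
    have e2 : exp (t • a) = u * exp (t.re • a) := by
      rw [hta, add_comm, exp_add_of_commute hcomm.symm]
    have e3 : exp (-(t • a)) = exp (-(t.re • a)) * v := by
      rw [hta, neg_add, exp_add_of_commute (hcomm.neg_left.neg_right)]
    have e4 : exp (-(t • a)) = v * exp (-(t.re • a)) := by
      rw [hta, neg_add, add_comm, exp_add_of_commute (hcomm.symm.neg_left.neg_right)]
    have hsplit : F t = v * (exp (-(t.re • a)) *
        E (exp (t.re • a) * (u * x * u) * exp (t.re • a)) * exp (-(t.re • a))) * v := by
      change exp (-(t • a)) * E (exp (t • a) * x * exp (t • a)) * exp (-(t • a)) = _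
      rw [show exp (t • a) * x * exp (t • a) =
        exp (t.re • a) * (u * x * u) * exp (t.re • a) by
          nth_rewrite 1 [e1]; rw [e2]; noncomm_ring]
      nth_rewrite 1 [e4]
      rw [e3]
      noncomm_ring
    have hnorm (y : A) : ‖v * y * v‖ = ‖y‖ := by
      rw [CStarRing.norm_mul_mem_unitary _ hvU, CStarRing.norm_mem_unitary_mul _ hvU]
    have hnorm' : ‖u * x * u‖ = ‖x‖ := by
      rw [CStarRing.norm_mul_mem_unitary _ huU, CStarRing.norm_mem_unitary_mul _ huU]
    have hfix' : E (exp ((2 * t.re) • a)) = exp ((2 * t.re) • a) := by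
      simpa only [Complex.coe_smul] using hfix ((2 * t.re : ℝ) : ℂ)
    rw [hsplit, hnorm, ← hnorm']
    set y := u * x * u
    have hy : y = (realPart y : A) + Complex.I • (imaginaryPart y : A) :=
      (realPart_add_I_smul_imaginaryPart y).symm
    have h3 := norm_exp_conj_map_le hE h1 ha t.re hfix' (realPart y).2
    have h4 := norm_exp_conj_map_le hE h1 ha t.re hfix' (imaginaryPart y).2
    conv_lhs => rw [hy]
    simp only [mul_add, add_mul, map_add, mul_smul_comm, smul_mul_assoc, map_smul]
    refine (norm_add_le _ _).trans ?_
    rw [norm_smul, Complex.norm_I, one_mul]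
    have h5 : ‖(realPart y : A)‖ ≤ ‖y‖ := realPart.norm_le y
    have h6 : ‖(imaginaryPart y : A)‖ ≤ ‖y‖ := imaginaryPart.norm_le y
    linarith
  have := hF.apply_eq_apply_of_bounded
    ((Metric.isBounded_closedBall (x := (0 : A)) (r := 2 * ‖x‖)).subset (by
      rintro _ ⟨t, rfl⟩
      simpa using hbound t)) t 0
  simpa [F] using this

open NormedSpace in
/-- The infinitesimal form of `map_exp_mul_mul_exp`. -/
theorem map_mul_add_mul_of_isSelfAdjoint {E : A →L[ℂ] A} (hE : ‖E‖ ≤ 1) {a : A}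
    (ha : IsSelfAdjoint a) (hfix : ∀ t : ℂ, E (exp (t • a)) = exp (t • a)) (x : A) :
    E (a * x + x * a) = a * E x + E x * a := by
  let _ := NormedAlgebra.restrictScalars ℚ ℂ A
  have hd : HasDerivAt (fun t : ℂ => exp (t • a)) a 0 := by
    simpa using hasDerivAt_exp_smul_const (𝕂 := ℂ) a 0
  have h (t : ℂ) : E (exp (t • a) * x * exp (t • a)) = exp (t • a) * E x * exp (t • a) := by
    have hinv : exp (t • a) * exp (-(t • a)) = 1 := by
      rw [← exp_add_of_commute (Commute.neg_right (Commute.refl _)), add_neg_cancel, exp_zero]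
    have hinv' : exp (-(t • a)) * exp (t • a) = 1 := by
      rw [← exp_add_of_commute (Commute.neg_left (Commute.refl _)), neg_add_cancel, exp_zero]
    rw [← map_exp_mul_mul_exp hE ha hfix x t]
    simp only [mul_assoc, hinv', mul_one]
    rw [← mul_assoc (exp (t • a)) (exp (-(t • a))), hinv, one_mul]
  have h2 : HasDerivAt (fun t : ℂ => E (exp (t • a) * x * exp (t • a))) (E (a * x + x * a)) 0 := by
    have := (hd.mul_const x).mul hd
    simp only [zero_smul, exp_zero, mul_one, one_mul] at this
    exact E.hasFDerivAt.comp_hasDerivAt 0 this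
  have h3 : HasDerivAt (fun t : ℂ => exp (t • a) * E x * exp (t • a)) (a * E x + E x * a) 0 := by
    have := (hd.mul_const (E x)).mul hd
    simp only [zero_smul, exp_zero, mul_one, one_mul] at this
    exact this
  exact h2.unique (by simpa only [h] using h3)

/-- A norm one projection `E` onto a unital star subalgebra `S` is a map of Jordan modules
over `S`. -/
theorem map_mul_add_mul_of_mem {E : A →L[ℂ] A} (hE : ‖E‖ ≤ 1) (S : StarSubalgebra ℂ A)
    (hS : ∀ a, a ∈ S ↔ E a = a) {a : A} (ha : a ∈ S) (x : A) :
    E (a * x + x * a) = a * E x + E x * a := by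
  have hclosed : IsClosed (S : Set A) := by
    have : (S : Set A) = {a | E a = a} := Set.ext hS
    rw [this]
    exact isClosed_eq E.continuous continuous_id
  have hsa {b : A} (hb : b ∈ S) (hb' : IsSelfAdjoint b) :
      E (b * x + x * b) = b * E x + E x * b := by
    let _ := NormedAlgebra.restrictScalars ℚ ℂ A
    refine map_mul_add_mul_of_isSelfAdjoint hE hb' (fun t => (hS _).1 ?_) x
    exact NormedSpace.exp_mem (R := ℂ) hclosed (S.smul_mem hb t)
  have hre : (realPart a : A) ∈ S := by
    rw [realPart_apply_coe, ← Complex.coe_smul]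
    exact S.smul_mem (add_mem ha (star_mem ha)) _
  have him : (imaginaryPart a : A) ∈ S := by
    rw [imaginaryPart_apply_coe, ← Complex.coe_smul]
    exact S.smul_mem (S.smul_mem (sub_mem ha (star_mem ha)) _) _
  have h1 := hsa hre (realPart a).2
  have h2 := hsa him (imaginaryPart a).2
  rw [← realPart_add_I_smul_imaginaryPart a]
  simp only [add_mul, mul_add, smul_mul_assoc, mul_smul_comm, map_add, map_smul] at h1 h2 ⊢
  calc _ = (E (↑(realPart a) * x) + E (x * ↑(realPart a))) +
        Complex.I • (E (↑(imaginaryPart a) * x) + E (x * ↑(imaginaryPart a))) := by module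
    _ = _ := by rw [h1, h2]; module

/-- A norm one projection `E` onto a unital star subalgebra `S` satisfies a symmetrized form of
equivariance for the conjugation by a unitary of `S`. -/
theorem map_conj_add_conj {E : A →L[ℂ] A} (hE : ‖E‖ ≤ 1) (S : StarSubalgebra ℂ A)
    (hS : ∀ a, a ∈ S ↔ E a = a) {a : A} (ha : a ∈ S) (ha' : a ∈ unitary A) (x : A) :
    E (a * x * star a) + E (star a * x * a) = a * E x * star a + star a * E x * a := by
  have hl := Unitary.star_mul_self_of_mem ha'
  have hr := Unitary.mul_star_self_of_mem ha'
  have key (y : A) : a * (star a * y + y * star a) + (star a * y + y * star a) * a =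
      (2 : ℂ) • y + (a * y * star a + star a * y * a) := by
    calc _ = (a * star a) * y + y * (star a * a) + (a * y * star a + star a * y * a) := by
          noncomm_ring
      _ = _ := by rw [hl, hr, one_mul, mul_one, two_smul]
  have h1 := map_mul_add_mul_of_mem hE S hS ha (star a * x + x * star a)
  rw [key, map_mul_add_mul_of_mem hE S hS (star_mem ha), key, map_add, map_smul, map_add] at h1
  exact add_left_cancel h1

/-- A bounded arithmetic progression is constant. -/
theorem eq_of_add_eq_two_mul_of_bounded {b : ℕ → ℂ} (hb : ∀ n, b (n + 2) + b n = 2 * b (n + 1))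
    {C : ℝ} (hC : ∀ n, ‖b n‖ ≤ C) : b 1 = b 0 := by
  have h (n : ℕ) : b n = b 0 + n * (b 1 - b 0) ∧ b (n + 1) = b 0 + (n + 1) * (b 1 - b 0) := by
    induction n with
    | zero => simp
    | succ n ih =>
      refine ⟨by rw [ih.2]; push_cast; ring, ?_⟩
      have := hb n
      rw [ih.1, ih.2] at this
      push_cast
      linear_combination this
  by_contra hne
  have hpos : 0 < ‖b 1 - b 0‖ := norm_pos_iff.2 (sub_ne_zero.2 hne)
  obtain ⟨n, hn⟩ := exists_nat_gt ((C + ‖b 0‖) / ‖b 1 - b 0‖)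
  rw [div_lt_iff₀ hpos] at hn
  have h1 : (n : ℝ) * ‖b 1 - b 0‖ = ‖b n - b 0‖ := by
    rw [(h n).1, add_sub_cancel_left, norm_mul, Complex.norm_natCast]
  have h2 := norm_sub_le (b n) (b 0)
  linarith [hC n]

/-- Let `E` be a norm one projection onto a unital star subalgebra `S`, and `φ` a functional which
on `S` is invariant under the conjugation by a unitary `a` of `S`. Then `φ ∘ E` is invariant under
this conjugation. The values of `φ ∘ E` along the orbit of `x` form an arithmetic progression by
`map_conj_add_conj`, and they are bounded. -/
theorem apply_map_conj {E : A →L[ℂ] A} (hE : ‖E‖ ≤ 1) (S : StarSubalgebra ℂ A)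
    (hS : ∀ a, a ∈ S ↔ E a = a) {a : A} (ha : a ∈ S) (ha' : a ∈ unitary A) (φ : A →L[ℂ] ℂ)
    (hφ : ∀ x, φ (a * E x * star a) = φ (E x)) (hφ' : ∀ x, φ (star a * E x * a) = φ (E x))
    (x : A) : φ (E (a * x * star a)) = φ (E x) := by
  let b : ℕ → ℂ := fun n => φ (E (a ^ n * x * star (a ^ n)))
  have hb (n : ℕ) : b (n + 2) + b n = 2 * b (n + 1) := by
    have h := map_conj_add_conj hE S hS ha ha' (a ^ (n + 1) * x * star (a ^ (n + 1)))
    have e1 : a * (a ^ (n + 1) * x * star (a ^ (n + 1))) * star a =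
        a ^ (n + 2) * x * star (a ^ (n + 2)) := by
      rw [pow_succ' a (n + 1), star_mul]
      noncomm_ring
    have e2 : star a * (a ^ (n + 1) * x * star (a ^ (n + 1))) * a = a ^ n * x * star (a ^ n) := by
      rw [pow_succ' a n, star_mul]
      calc _ = (star a * a) * (a ^ n * x * star (a ^ n)) * (star a * a) := by noncomm_ring
        _ = _ := by rw [Unitary.star_mul_self_of_mem ha', one_mul, mul_one]
    rw [e1, e2] at h
    have h2 := congrArg φ h
    rw [map_add, map_add, hφ, hφ'] at h2
    simp only [b]
    rw [h2, two_mul]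
  have hC (n : ℕ) : ‖b n‖ ≤ ‖φ‖ * ‖x‖ := by
    have hn := pow_mem ha' n
    refine φ.le_opNorm_of_le ((E.le_of_opNorm_le hE _).trans ?_)
    rw [one_mul, CStarRing.norm_mul_mem_unitary _ (Unitary.star_mem hn),
      CStarRing.norm_mem_unitary_mul _ hn]
  simpa [b] using eq_of_add_eq_two_mul_of_bounded hb hC

end CStarAlgebra

/-! ### The standard form of a group von Neumann algebra -/

namespace VonNeumannAlgebra.FaithfulNormalTrace

variable {K : Type w} [NormedAddCommGroup K] [InnerProductSpace ℂ K] [CompleteSpace K]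
  {N : VonNeumannAlgebra K} (τ : FaithfulNormalTrace N)

theorem leftRep_coe (a x : N.toStarSubalgebra) :
    τ.leftRep a (τ.toFunctional.toPreGNS x : τ.L2) = (τ.toFunctional.toPreGNS (a * x) : τ.L2) :=
  PositiveLinearMap.gnsNonUnitalStarAlgHom_apply_coe _

theorem conj_coe (x : N.toStarSubalgebra) :
    τ.conj (τ.toFunctional.toPreGNS x : τ.L2) = (τ.toFunctional.toPreGNS (star x) : τ.L2) :=
  ContinuousLinearMap.completion_apply_coe τ.preConj _

/-- The orbit map `x ↦ x Ω` of a vector `Ω`. -/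
noncomputable def orbitMap (Ω : K) : τ.toFunctional.PreGNS →ₗ[ℂ] K :=
  (ContinuousLinearMap.apply ℂ K Ω).toLinearMap ∘ₗ
    N.toStarSubalgebra.toSubalgebra.val.toLinearMap ∘ₗ τ.toFunctional.ofPreGNS.toLinearMap

theorem norm_orbitMap {Ω : K} (hτ : ∀ x : N.toStarSubalgebra,
    τ.toFunctional x = ⟪Ω, (x : K →L[ℂ] K) Ω⟫_ℂ) (x : τ.toFunctional.PreGNS) :
    ‖τ.orbitMap Ω x‖ = ‖x‖ := by
  obtain ⟨y, rfl⟩ := τ.toFunctional.toPreGNS.surjective x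
  have h := PositiveLinearMap.preGNS_norm_sq τ.toFunctional (τ.toFunctional.toPreGNS y)
  rw [hτ] at h
  have h2 := ContinuousLinearMap.adjoint_inner_right (y : K →L[ℂ] K) Ω ((y : K →L[ℂ] K) Ω)
  rw [inner_self_eq_norm_sq_to_K] at h2
  have h3 := h.trans h2
  have h' : ‖τ.toFunctional.toPreGNS y‖ ^ 2 = ‖(y : K →L[ℂ] K) Ω‖ ^ 2 :=
    Complex.ofReal_injective (by simpa using h3)
  exact ((sq_eq_sq₀ (norm_nonneg _) (norm_nonneg _)).1 h').symm

/-- If `τ` is the vector state of a cyclic vector `Ω`, then `L²(N, τ)` is the space on which `N`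
acts, with its given representation. The conjugation is determined by its values on the orbit
of `Ω`. -/
theorem exists_l2Equiv {Ω : K} (hτ : ∀ x : N.toStarSubalgebra,
      τ.toFunctional x = ⟪Ω, (x : K →L[ℂ] K) Ω⟫_ℂ)
    (hΩ : Dense (Set.range fun x : N.toStarSubalgebra => (x : K →L[ℂ] K) Ω))
    {J : K → K} (hJ : Continuous J)
    (hJΩ : ∀ x : N.toStarSubalgebra, J ((x : K →L[ℂ] K) Ω) = star (x : K →L[ℂ] K) Ω) :
    ∃ U : τ.L2 ≃ₗᵢ[ℂ] K, (∀ a ξ, U (τ.leftRep a ξ) = (a : K →L[ℂ] K) (U ξ)) ∧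
      ∀ ξ, U (τ.conj ξ) = J (U ξ) := by
  have hdense : DenseRange (τ.orbitMap Ω) := hΩ
  have hnorm (x : τ.toFunctional.PreGNS) : ‖τ.orbitMap Ω x‖ =
      ‖(UniformSpace.Completion.toComplL (𝕜 := ℂ) (E := τ.toFunctional.PreGNS)).toLinearMap x‖ :=
    (τ.norm_orbitMap hτ x).trans (UniformSpace.Completion.norm_coe x).symm
  let U : τ.L2 ≃ₗᵢ[ℂ] K := (LinearEquiv.refl ℂ τ.toFunctional.PreGNS).extendOfIsometry
    UniformSpace.Completion.toComplL.toLinearMap (τ.orbitMap Ω)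
    UniformSpace.Completion.denseRange_coe hdense hnorm
  have hU (x : N.toStarSubalgebra) :
      U (τ.toFunctional.toPreGNS x : τ.L2) = (x : K →L[ℂ] K) Ω :=
    LinearEquiv.extendOfIsometry_eq (LinearEquiv.refl ℂ τ.toFunctional.PreGNS)
      UniformSpace.Completion.toComplL.toLinearMap (τ.orbitMap Ω)
      UniformSpace.Completion.denseRange_coe hdense hnorm (τ.toFunctional.toPreGNS x)
  have hUc : Continuous U := U.continuous
  refine ⟨U, fun a ξ => ?_, fun ξ => ?_⟩
  · refine UniformSpace.Completion.induction_on ξ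
      (isClosed_eq (hUc.comp (τ.leftRep a).continuous)
        ((a : K →L[ℂ] K).continuous.comp hUc)) fun y => ?_
    obtain ⟨z, rfl⟩ := τ.toFunctional.toPreGNS.surjective y
    rw [leftRep_coe, hU, hU]
    rfl
  · refine UniformSpace.Completion.induction_on ξ
      (isClosed_eq (hUc.comp τ.conj.continuous) (hJ.comp hUc)) fun y => ?_
    obtain ⟨z, rfl⟩ := τ.toFunctional.toPreGNS.surjective y
    rw [conj_coe, hU, hU, hJΩ]
    rfl

end VonNeumannAlgebra.FaithfulNormalTrace

namespace GroupVonNeumannAlgebra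

variable {G : Type u} [Group G]

/-- The operator `λ(g)`, as an element of `L(G)`. -/
noncomputable def lam (g : G) : (L G).toStarSubalgebra :=
  ⟨leftReg g, VonNeumannAlgebra.subset_generatedBy _ ⟨g, rfl⟩⟩

theorem rightReg_apply (g : G) (f : ℓ²(G, ℂ)) (x : G) : rightReg g f x = f (x * g) := rfl

theorem star_leftReg (g : G) : star (leftReg g) = leftReg g⁻¹ := by
  rw [leftReg, star_compPerm]
  ext f x
  change f ((g⁻¹)⁻¹ * x) = f ((g⁻¹)⁻¹ * x)
  rfl

theorem leftReg_delta (g x : G) : leftReg g (delta x) = delta (g * x) := by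
  classical
  ext y
  change (delta x) (g⁻¹ * y) = delta (g * x) y
  simp only [delta, lp.single_apply, Pi.single_apply, inv_mul_eq_iff_eq_mul]

theorem leftReg_mul_leftReg (g k : G) : leftReg g * leftReg k = leftReg (g * k) := by
  ext f x
  change f (k⁻¹ * (g⁻¹ * x)) = f ((g * k)⁻¹ * x)
  rw [mul_inv_rev, mul_assoc]

theorem leftReg_one : leftReg (1 : G) = 1 := by
  ext f x
  change f (1⁻¹ * x) = f x
  simp

theorem star_lam (g : G) : star (lam g) = lam g⁻¹ := Subtype.ext (star_leftReg g)

theorem lam_mul_lam (g k : G) : lam g * lam k = lam (g * k) :=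
  Subtype.ext (leftReg_mul_leftReg g k)

theorem lam_one : lam (1 : G) = 1 := Subtype.ext leftReg_one

/-- The vector `δ_1` is cyclic for `L(G)`. -/
theorem dense_orbit :
    Dense (Set.range fun x : (L G).toStarSubalgebra =>
      (x : ℓ²(G, ℂ) →L[ℂ] ℓ²(G, ℂ)) (delta 1)) := by
  let S : Submodule ℂ ℓ²(G, ℂ) :=
    LinearMap.range ((ContinuousLinearMap.apply ℂ ℓ²(G, ℂ) (delta (1 : G))).toLinearMap ∘ₗ
      (L G).toStarSubalgebra.toSubalgebra.val.toLinearMap)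
  have h : S.topologicalClosure = ⊤ := by
    rw [Submodule.topologicalClosure_eq_top_iff, Submodule.eq_bot_iff]
    intro f hf
    ext g
    rw [← inner_delta]
    refine (Submodule.mem_orthogonal _ _).1 hf _ ⟨lam g, ?_⟩
    change leftReg g (delta 1) = delta g
    rw [leftReg_delta, mul_one]
  exact (Submodule.dense_iff_topologicalClosure_eq_top).2 h

/-- The conjugation `(J f)(x) = conj (f (x⁻¹))` of `ℓ²(G)`. -/
noncomputable def conjInv (f : ℓ²(G, ℂ)) : ℓ²(G, ℂ) := star (compPerm (Equiv.inv G) f)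

theorem conjInv_apply (f : ℓ²(G, ℂ)) (x : G) : conjInv f x = starRingEnd ℂ (f x⁻¹) := rfl

theorem continuous_conjInv : Continuous (conjInv (G := G)) :=
  continuous_star.comp (compPerm (Equiv.inv G)).continuous

/-- On the orbit of `δ_1`, the conjugation is `x δ_1 ↦ x* δ_1`. -/
theorem conjInv_delta {x : ℓ²(G, ℂ) →L[ℂ] ℓ²(G, ℂ)} (hx : x ∈ L G) :
    conjInv (x (delta 1)) = star x (delta 1) := by
  ext g
  rw [conjInv_apply, ← inner_delta g (star x (delta 1)), ContinuousLinearMap.star_eq_adjoint,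
    ContinuousLinearMap.adjoint_inner_right, apply_delta G hx g, ← inner_conj_symm,
    inner_delta, rightReg_apply, one_mul]

variable (G) in
/-- The standard form of `L(G)`: the space `L²(L(G), τ)` is `ℓ²(G)`. -/
theorem exists_l2Equiv : ∃ U : (trace G).L2 ≃ₗᵢ[ℂ] ℓ²(G, ℂ),
    (∀ a ξ, U ((trace G).leftRep a ξ) = (a : ℓ²(G, ℂ) →L[ℂ] ℓ²(G, ℂ)) (U ξ)) ∧
      ∀ ξ, U ((trace G).conj ξ) = conjInv (U ξ) :=
  (trace G).exists_l2Equiv (fun _ => rfl) dense_orbit continuous_conjInv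
    fun x => conjInv_delta x.2

end GroupVonNeumannAlgebra

/-! ### The basic construction of a subgroup -/

namespace GroupVonNeumannAlgebra

variable {G : Type u} [Group G]

/-- The bounded real functions on `G` which are invariant under right translation by `H`, that is,
the bounded functions on `G/H`. -/
def boundedInvariant (H : Subgroup G) : Submodule ℝ (G → ℝ) where
  carrier := {f | (∃ C, ∀ x, |f x| ≤ C) ∧ ∀ x, ∀ h ∈ H, f (x * h) = f x}
  add_mem' := by
    rintro f f' ⟨⟨C, hC⟩, hf⟩ ⟨⟨C', hC'⟩, hf'⟩
    exact ⟨⟨C + C', fun x => (abs_add_le _ _).trans (add_le_add (hC x) (hC' x))⟩,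
      fun x h hh => by simp [hf x h hh, hf' x h hh]⟩
  zero_mem' := ⟨⟨0, by simp⟩, by simp⟩
  smul_mem' := by
    rintro c f ⟨⟨C, hC⟩, hf⟩
    refine ⟨⟨|c| * C, fun x => ?_⟩, fun x h hh => by simp [hf x h hh]⟩
    simpa [abs_mul] using mul_le_mul_of_nonneg_left (hC x) (abs_nonneg c)

/-- An invariant mean for the left action of `G` on the bounded functions on `G/H`. -/
structure IsInvariantMean (H : Subgroup G) (m : boundedInvariant H →ₗ[ℝ] ℝ) : Prop where
  abs_le : ∀ (f : boundedInvariant H) (C : ℝ), (∀ x, |f.1 x| ≤ C) → |m f| ≤ C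
  map_one : ∀ f : boundedInvariant H, (∀ x, f.1 x = 1) → m f = 1
  map_translate : ∀ (g : G) (f f' : boundedInvariant H), (∀ x, f'.1 x = f.1 (g⁻¹ * x)) → m f' = m f

section StandardForm

variable {𝓗 : Type w} [NormedAddCommGroup 𝓗] [InnerProductSpace ℂ 𝓗]
  (U : 𝓗 ≃ₗᵢ[ℂ] ℓ²(G, ℂ))

/-- The multiplication by a bounded real function, carried over to `𝓗` by `U`. -/
noncomputable def diag (f : G → ℝ) {C : ℝ} (hC : 0 ≤ C) (hf : ∀ x, |f x| ≤ C) : 𝓗 →L[ℂ] 𝓗 :=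
  (U.symm.toContinuousLinearEquiv : ℓ²(G, ℂ) →L[ℂ] 𝓗) ∘L
    (lp.mapCLM 2 (fun x => (f x : ℂ) • ContinuousLinearMap.id ℂ ℂ) hC fun x => by
      simpa [norm_smul] using hf x) ∘L (U.toContinuousLinearEquiv : 𝓗 →L[ℂ] ℓ²(G, ℂ))

omit [Group G] in
theorem map_diag_apply {f : G → ℝ} {C : ℝ} (hC : 0 ≤ C) (hf : ∀ x, |f x| ≤ C) (ξ : 𝓗) (x : G) :
    U (diag U f hC hf ξ) x = f x * U ξ x := by
  simp [diag]

omit [Group G] in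
theorem norm_diag_le {f : G → ℝ} {C : ℝ} (hC : 0 ≤ C) (hf : ∀ x, |f x| ≤ C) :
    ‖diag U f hC hf‖ ≤ C := by
  refine ContinuousLinearMap.opNorm_le_bound _ hC fun ξ => ?_
  rw [diag, ContinuousLinearMap.comp_apply, ContinuousLinearMap.comp_apply]
  refine (U.symm.norm_map _).trans_le ?_
  rw [← U.norm_map ξ]
  exact ContinuousLinearMap.le_of_opNorm_le _ (lp.norm_mapCLM_le _ _ hC _) _

omit [Group G] in
theorem ext_of_map {ξ η : 𝓗} (h : ∀ x, U ξ x = U η x) : ξ = η :=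
  U.injective (lp.ext (funext h))

variable [CompleteSpace 𝓗]

/-- The basic construction for `B ⊆ L(G)`, for a representation `π` of `L(G)` and a conjugation `J`:
the commutant of `J π(B) J`. -/
noncomputable def basic (π : (L G).toStarSubalgebra →⋆ₐ[ℂ] (𝓗 →L[ℂ] 𝓗)) (J : 𝓗 →L⋆[ℂ] 𝓗)
    (B : VonNeumannAlgebra ℓ²(G, ℂ)) : VonNeumannAlgebra 𝓗 :=
  VonNeumannAlgebra.commutantOf {T | ∃ b : (L G).toStarSubalgebra,
    (b : ℓ²(G, ℂ) →L[ℂ] ℓ²(G, ℂ)) ∈ B ∧ T = J.comp ((π b).comp J)}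

omit [Group G] in
theorem star_diag {f : G → ℝ} {C : ℝ} (hC : 0 ≤ C) (hf : ∀ x, |f x| ≤ C) :
    star (diag U f hC hf) = diag U f hC hf := by
  refine ((ContinuousLinearMap.eq_adjoint_iff _ _).2 fun ξ η => ?_).symm
  rw [← U.inner_map_map, ← U.inner_map_map ξ, lp.inner_eq_tsum, lp.inner_eq_tsum]
  refine tsum_congr fun x => ?_
  rw [map_diag_apply, map_diag_apply]
  simp only [RCLike.inner_apply, map_mul, Complex.conj_ofReal]
  ring

variable {U} {π : (L G).toStarSubalgebra →⋆ₐ[ℂ] (𝓗 →L[ℂ] 𝓗)} {J : 𝓗 →L⋆[ℂ] 𝓗}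
  (hπ : ∀ a ξ, U (π a ξ) = (a : ℓ²(G, ℂ) →L[ℂ] ℓ²(G, ℂ)) (U ξ))
  (hJ : ∀ ξ, U (J ξ) = conjInv (U ξ))

include hπ in
theorem map_pi_lam_apply (g : G) (ξ : 𝓗) (x : G) : U (π (lam g) ξ) x = U ξ (g⁻¹ * x) := by
  rw [hπ]
  rfl

include hπ in
/-- The operators of `L(H)` commute with the multiplications by functions on `H\G`. -/
theorem commute_pi_diag {H : Subgroup G} {b : (L G).toStarSubalgebra}
    (hb : (b : ℓ²(G, ℂ) →L[ℂ] ℓ²(G, ℂ)) ∈ subgroupL H) {f : G → ℝ} {C : ℝ} (hC : 0 ≤ C)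
    (hf : ∀ x, |f x| ≤ C) (hinv : ∀ x, ∀ h ∈ H, f (h * x) = f x) (ξ : 𝓗) :
    π b (diag U f hC hf ξ) = diag U f hC hf (π b ξ) := by
  let D : ℓ²(G, ℂ) →L[ℂ] ℓ²(G, ℂ) := diag (LinearIsometryEquiv.refl ℂ _) f hC hf
  have hD (ζ : ℓ²(G, ℂ)) (x : G) : D ζ x = f x * ζ x :=
    map_diag_apply (LinearIsometryEquiv.refl ℂ _) hC hf ζ x
  have hcomm (h : G) (hh : h ∈ H) : leftReg h * D = D * leftReg h := by
    ext ζ x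
    change D ζ (h⁻¹ * x) = D (leftReg h ζ) x
    rw [hD, hD, hinv x _ (inv_mem hh)]
    rfl
  have hmem : D ∈ VonNeumannAlgebra.commutantOf (leftReg '' (H : Set G)) := by
    refine VonNeumannAlgebra.mem_commutantOf.2 ?_
    rintro _ ⟨h, hh, rfl⟩
    refine ⟨hcomm h hh, ?_⟩
    rw [star_leftReg]
    exact hcomm _ (inv_mem hh)
  have h1 := VonNeumannAlgebra.mem_generatedBy.1 hb D hmem
  have h2 : U (diag U f hC hf ξ) = D (U ξ) := by
    ext x
    rw [map_diag_apply, hD]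
  apply U.injective
  rw [hπ, h2]
  ext x
  rw [map_diag_apply, hπ, ← hD]
  exact congrArg (fun T : ℓ²(G, ℂ) →L[ℂ] ℓ²(G, ℂ) => T (U ξ) x) h1.symm

include hπ hJ in
/-- The multiplications by functions on `G/H` belong to the basic construction for
`L(H) ⊆ L(G)`. -/
theorem diag_mem {H : Subgroup G} {f : G → ℝ} {C : ℝ} (hC : 0 ≤ C)
    (hf : ∀ x, |f x| ≤ C) (hinv : ∀ x, ∀ h ∈ H, f (x * h) = f x) :
    diag U f hC hf ∈ basic π J (subgroupL H) := by
  have hf' (x : G) : |f x⁻¹| ≤ C := hf _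
  have hJd (ξ : 𝓗) : J (diag U f hC hf ξ) = diag U (fun x => f x⁻¹) hC hf' (J ξ) := by
    refine ext_of_map U fun x => ?_
    rw [hJ, conjInv_apply, map_diag_apply, map_diag_apply, hJ, conjInv_apply]
    simp
  have hJd' (ξ : 𝓗) : J (diag U (fun x => f x⁻¹) hC hf' ξ) = diag U f hC hf (J ξ) := by
    refine ext_of_map U fun x => ?_
    rw [hJ, conjInv_apply, map_diag_apply, map_diag_apply, hJ, conjInv_apply]
    simp
  refine VonNeumannAlgebra.mem_commutantOf.2 ?_
  rintro _ ⟨b, hb, rfl⟩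
  have key : J.comp ((π b).comp J) * diag U f hC hf = diag U f hC hf * J.comp ((π b).comp J) := by
    ext1 ξ
    change J (π b (J (diag U f hC hf ξ))) = diag U f hC hf (J (π b (J ξ)))
    rw [hJd, commute_pi_diag hπ hb hC hf', hJd']
    intro x h hh
    rw [mul_inv_rev, hinv _ _ (inv_mem hh)]
  refine ⟨key, ?_⟩
  have := congrArg star key
  rw [star_mul, star_mul, star_diag] at this
  exact this.symm

include hπ in
theorem pi_lam_mul_diag_mul (g : G) {f f' : G → ℝ} {C : ℝ} (hC : 0 ≤ C) (hf : ∀ x, |f x| ≤ C)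
    (hf' : ∀ x, |f' x| ≤ C) (h : ∀ x, f' x = f (g⁻¹ * x)) :
    π (lam g) * diag U f hC hf * star (π (lam g)) = diag U f' hC hf' := by
  rw [← map_star, star_lam]
  ext1 ξ
  refine ext_of_map U fun x => ?_
  change U (π (lam g) (diag U f hC hf (π (lam g⁻¹) ξ))) x = _
  rw [map_pi_lam_apply hπ, map_diag_apply, map_pi_lam_apply hπ, map_diag_apply, h]
  simp

include hπ hJ in
/-- `J L(G) J` commutes with the representation of `L(G)`. -/
theorem pi_commute_conj_pi_conj (a b : (L G).toStarSubalgebra) :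
    J.comp ((π b).comp J) * π a = π a * J.comp ((π b).comp J) := by
  -- Transported to `ℓ²(G)`, the operator `J b J` commutes with the left translations.
  let D : ℓ²(G, ℂ) →L[ℂ] ℓ²(G, ℂ) := (U.toContinuousLinearEquiv : 𝓗 →L[ℂ] ℓ²(G, ℂ)) ∘L
    (J.comp ((π b).comp J)) ∘L (U.symm.toContinuousLinearEquiv : ℓ²(G, ℂ) →L[ℂ] 𝓗)
  have hDU (ξ : 𝓗) : D (U ξ) = U (J (π b (J ξ))) := by simp [D]
  have hD (ζ : ℓ²(G, ℂ)) : D ζ =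
      conjInv ((b : ℓ²(G, ℂ) →L[ℂ] ℓ²(G, ℂ)) (conjInv ζ)) := by
    obtain ⟨ξ, rfl⟩ := U.surjective ζ
    rw [hDU, hJ, hπ, hJ]
  have hl (g : G) (ζ : ℓ²(G, ℂ)) : conjInv (leftReg g ζ) = rightReg g (conjInv ζ) := by
    ext x
    change starRingEnd ℂ (ζ (g⁻¹ * x⁻¹)) = starRingEnd ℂ (ζ (x * g)⁻¹)
    rw [mul_inv_rev]
  have hr (g : G) (ζ : ℓ²(G, ℂ)) : conjInv (rightReg g ζ) = leftReg g (conjInv ζ) := by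
    ext x
    change starRingEnd ℂ (ζ (x⁻¹ * g)) = starRingEnd ℂ (ζ (g⁻¹ * x)⁻¹)
    rw [mul_inv_rev, inv_inv]
  have hcomm (g : G) : leftReg g * D = D * leftReg g := by
    ext1 ζ
    change leftReg g (D ζ) = D (leftReg g ζ)
    rw [hD, hD, hl, ← hr]
    exact congrArg (fun T : ℓ²(G, ℂ) →L[ℂ] ℓ²(G, ℂ) => conjInv (T (conjInv ζ)))
      (commute_rightReg G b.2 g)
  have hmem : D ∈ VonNeumannAlgebra.commutantOf (Set.range (leftReg (G := G))) := by
    refine VonNeumannAlgebra.mem_commutantOf.2 ?_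
    rintro _ ⟨g, rfl⟩
    refine ⟨hcomm g, ?_⟩
    rw [star_leftReg]
    exact hcomm _
  have h1 := VonNeumannAlgebra.mem_generatedBy.1 a.2 D hmem
  ext1 ξ
  apply U.injective
  change U (J (π b (J (π a ξ)))) = U (π a (J (π b (J ξ))))
  rw [hπ a, ← hDU, ← hDU, hπ]
  exact congrArg (fun T : ℓ²(G, ℂ) →L[ℂ] ℓ²(G, ℂ) => T (U ξ)) h1

include hπ hJ in
/-- The basic construction contains `L(G)`. -/
theorem pi_mem (H : Subgroup G) (a : (L G).toStarSubalgebra) :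
    π a ∈ basic π J (subgroupL H) := by
  refine VonNeumannAlgebra.mem_commutantOf.2 ?_
  rintro _ ⟨b, -, rfl⟩
  refine ⟨pi_commute_conj_pi_conj hπ hJ a b, ?_⟩
  have := congrArg star (pi_commute_conj_pi_conj hπ hJ (star a) b)
  rw [star_mul, star_mul, map_star, star_star] at this
  exact this.symm

omit [Group G] in
theorem mul_delta_apply (S T : ℓ²(G, ℂ) →L[ℂ] ℓ²(G, ℂ)) (g k : G) :
    (S * T) (delta g) k = ∑' x, S (delta x) k * T (delta g) x := by
  rw [← inner_delta]
  change ⟪delta k, S (T (delta g))⟫_ℂ = _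
  rw [← ContinuousLinearMap.adjoint_inner_left, lp.inner_eq_tsum]
  refine tsum_congr fun x => ?_
  have h : (ContinuousLinearMap.adjoint S (delta k)) x = starRingEnd ℂ (S (delta x) k) := by
    rw [← inner_delta, ContinuousLinearMap.adjoint_inner_right, ← inner_conj_symm, inner_delta]
  rw [h]
  simp [mul_comm]

/-- The operators which commute with the right translations commute with the operators which commute
with the left translations: the former are left convolutions and the latter right convolutions. -/
theorem commute_of_commute_rightReg_of_commute_leftReg {S T : ℓ²(G, ℂ) →L[ℂ] ℓ²(G, ℂ)}
    (hT : ∀ g, rightReg g * T = T * rightReg g) (hS : ∀ g, leftReg g * S = S * leftReg g) :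
    S * T = T * S := by
  have hT' (g x : G) : T (delta g) x = T (delta 1) (x * g⁻¹) := by
    have := congrArg (fun R : ℓ²(G, ℂ) →L[ℂ] ℓ²(G, ℂ) => R (delta 1) x) (hT g⁻¹)
    change T (delta 1) (x * g⁻¹) = T (rightReg g⁻¹ (delta 1)) x at this
    rw [this, rightReg_delta, one_mul, inv_inv]
  have hS' (g x : G) : S (delta g) x = S (delta 1) (g⁻¹ * x) := by
    have := congrArg (fun R : ℓ²(G, ℂ) →L[ℂ] ℓ²(G, ℂ) => R (delta 1) x) (hS g)
    change S (delta 1) (g⁻¹ * x) = S (leftReg g (delta 1)) x at this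
    rw [this, leftReg_delta, mul_one]
  rw [← sub_eq_zero]
  refine ext_delta fun g => ?_
  rw [sub_apply, sub_eq_zero]
  ext k
  rw [mul_delta_apply, mul_delta_apply,
    ← ((Equiv.inv G).trans ((Equiv.mulLeft k).trans (Equiv.mulRight g))).tsum_eq]
  refine tsum_congr fun x => ?_
  rw [hT' g, hS', hT' x, hS' g]
  change S (delta 1) ((k * x⁻¹ * g)⁻¹ * k) * T (delta 1) (k * x⁻¹ * g * g⁻¹) = _
  rw [mul_comm, mul_inv_cancel_right, mul_inv_rev, mul_inv_rev, inv_inv]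
  simp [mul_assoc]

include hπ hJ in
/-- The commutation theorem: an operator which commutes with the right translations `J λ(g) J`
belongs to `L(G)`. -/
theorem mem_range_pi {T : 𝓗 →L[ℂ] 𝓗}
    (hT : ∀ g ξ, T (J (π (lam g) (J ξ))) = J (π (lam g) (J (T ξ)))) : T ∈ Set.range π := by
  let T' : ℓ²(G, ℂ) →L[ℂ] ℓ²(G, ℂ) := (U.toContinuousLinearEquiv : 𝓗 →L[ℂ] ℓ²(G, ℂ)) ∘L
    T ∘L (U.symm.toContinuousLinearEquiv : ℓ²(G, ℂ) →L[ℂ] 𝓗)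
  have hT' (ξ : 𝓗) : T' (U ξ) = U (T ξ) := by simp [T']
  have hR (g : G) (ξ : 𝓗) : U (J (π (lam g) (J ξ))) = rightReg g (U ξ) := by
    ext x
    rw [hJ, conjInv_apply, map_pi_lam_apply hπ, hJ, conjInv_apply, rightReg_apply]
    simp
  have hcomm (g : G) : rightReg g * T' = T' * rightReg g := by
    ext1 ζ
    obtain ⟨ξ, rfl⟩ := U.surjective ζ
    change rightReg g (T' (U ξ)) = T' (rightReg g (U ξ))
    rw [hT', ← hR, ← hR, hT', hT]
  have hmem : T' ∈ L G := VonNeumannAlgebra.mem_generatedBy.2 fun S hS =>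
    commute_of_commute_rightReg_of_commute_leftReg hcomm fun g =>
      (VonNeumannAlgebra.mem_commutantOf.1 hS _ ⟨g, rfl⟩).1
  refine ⟨⟨T', hmem⟩, ?_⟩
  ext1 ξ
  apply U.injective
  rw [hπ, ← hT']

/-- The multiplication operators, as elements of the basic construction. -/
noncomputable def diagMap (hπ : ∀ a ξ, U (π a ξ) = (a : ℓ²(G, ℂ) →L[ℂ] ℓ²(G, ℂ)) (U ξ))
    (hJ : ∀ ξ, U (J ξ) = conjInv (U ξ)) (H : Subgroup G) :
    boundedInvariant H →ₗ[ℝ] (basic π J (subgroupL H)).toStarSubalgebra where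
  toFun f := ⟨diag U f.1 ((abs_nonneg _).trans (f.2.1.choose_spec 1)) f.2.1.choose_spec,
    diag_mem hπ hJ _ _ f.2.2⟩
  map_add' f f' := Subtype.ext <| by
    ext1 ξ
    refine ext_of_map U fun x => ?_
    simp [map_diag_apply, add_mul]
  map_smul' c f := Subtype.ext <| by
    ext1 ξ
    refine ext_of_map U fun x => ?_
    change _ = U (c • diag U f.1 ((abs_nonneg _).trans (f.2.1.choose_spec 1))
      f.2.1.choose_spec ξ) x
    rw [← Complex.coe_smul, map_smul, lp.coeFn_smul, Pi.smul_apply, map_diag_apply, map_diag_apply]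
    simp [mul_assoc]

theorem map_diagMap_apply (H : Subgroup G) (f : boundedInvariant H) (ξ : 𝓗) (x : G) :
    U ((diagMap hπ hJ H f : 𝓗 →L[ℂ] 𝓗) ξ) x = f.1 x * U ξ x :=
  map_diag_apply U ((abs_nonneg _).trans (f.2.1.choose_spec 1)) f.2.1.choose_spec ξ x

theorem coe_diagMap (H : Subgroup G) (f : boundedInvariant H) {C : ℝ} (hC : 0 ≤ C)
    (hf : ∀ x, |f.1 x| ≤ C) :
    (diagMap hπ hJ H f : 𝓗 →L[ℂ] 𝓗) = diag U f.1 hC hf := by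
  ext1 ξ
  refine ext_of_map U fun x => ?_
  rw [map_diag_apply, map_diagMap_apply]

/-- The representation of `L(G)`, with values in the basic construction. -/
noncomputable def piMap (hπ : ∀ a ξ, U (π a ξ) = (a : ℓ²(G, ℂ) →L[ℂ] ℓ²(G, ℂ)) (U ξ))
    (hJ : ∀ ξ, U (J ξ) = conjInv (U ξ)) (H : Subgroup G) (a : (L G).toStarSubalgebra) :
    (basic π J (subgroupL H)).toStarSubalgebra := ⟨π a, pi_mem hπ hJ H a⟩

theorem star_piMap (H : Subgroup G) (a : (L G).toStarSubalgebra) :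
    star (piMap hπ hJ H a) = piMap hπ hJ H (star a) := Subtype.ext (map_star π a).symm

theorem piMap_mul (H : Subgroup G) (a b : (L G).toStarSubalgebra) :
    piMap hπ hJ H a * piMap hπ hJ H b = piMap hπ hJ H (a * b) := Subtype.ext (map_mul π a b).symm

theorem piMap_one (H : Subgroup G) : piMap hπ hJ H 1 = 1 := Subtype.ext (map_one π)

theorem piMap_lam_mem_unitary (H : Subgroup G) (g : G) :
    piMap hπ hJ H (lam g) ∈ unitary (basic π J (subgroupL H)).toStarSubalgebra := by
  refine Unitary.mem_iff.2 ⟨?_, ?_⟩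
  · rw [star_piMap, piMap_mul, star_lam, lam_mul_lam, inv_mul_cancel, lam_one, piMap_one]
  · rw [star_piMap, piMap_mul, star_lam, lam_mul_lam, mul_inv_cancel, lam_one, piMap_one]

theorem piMap_lam_conj (H : Subgroup G) (g : G) {f f' : boundedInvariant H}
    (hff' : ∀ x, f'.1 x = f.1 (g⁻¹ * x)) :
    piMap hπ hJ H (lam g) * diagMap hπ hJ H f * star (piMap hπ hJ H (lam g)) =
      diagMap hπ hJ H f' := by
  obtain ⟨C, hC⟩ := f.2.1
  have hC0 : 0 ≤ C := (abs_nonneg _).trans (hC 1)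
  have hC' (x : G) : |f'.1 x| ≤ C := by rw [hff']; exact hC _
  refine Subtype.ext ?_
  rw [coe_diagMap hπ hJ H f' hC0 hC', ← pi_lam_mul_diag_mul hπ g hC0 hC hC' hff',
    ← coe_diagMap hπ hJ H f hC0 hC]
  rfl

/-- The trace extends to the vector state of `δ_1` on the basic construction. -/
theorem exists_extend_trace (H : Subgroup G) :
    ∃ φ : (basic π J (subgroupL H)).toStarSubalgebra →L[ℂ] ℂ,
      (∀ a, φ (piMap hπ hJ H a) = (trace G).toFunctional a) ∧ ∀ T, ‖φ T‖ ≤ ‖T‖ := by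
  let φ : (basic π J (subgroupL H)).toStarSubalgebra →L[ℂ] ℂ :=
    (innerSL ℂ (delta (1 : G))) ∘L (U.toContinuousLinearEquiv : 𝓗 →L[ℂ] ℓ²(G, ℂ)) ∘L
      (ContinuousLinearMap.apply ℂ 𝓗 (U.symm (delta 1))) ∘L
        ((basic π J (subgroupL H)).toStarSubalgebra.toSubalgebra.toSubmodule.subtypeL)
  have hφ (T : (basic π J (subgroupL H)).toStarSubalgebra) :
      φ T = ⟪delta 1, U ((T : 𝓗 →L[ℂ] 𝓗) (U.symm (delta 1)))⟫_ℂ := rfl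
  refine ⟨φ, fun a => ?_, fun T => ?_⟩
  · rw [hφ]
    change ⟪delta 1, U (π a (U.symm (delta 1)))⟫_ℂ = _
    rw [hπ, U.apply_symm_apply]
    rfl
  · have h1 : ‖delta (1 : G)‖ = 1 := by
      classical
      rw [delta, lp.norm_single (by simp), norm_one]
    rw [hφ]
    refine (norm_inner_le_norm _ _).trans ?_
    rw [h1, one_mul, U.norm_map]
    refine ((T : 𝓗 →L[ℂ] 𝓗).le_opNorm _).trans ?_
    rw [U.symm.norm_map, h1, mul_one]
    rfl

/-- For a norm one projection `Ψ` of the basic construction onto `L(G)`, the functional `τ ∘ Ψ` is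
invariant under the conjugation by the unitaries `λ(g)`. -/
theorem apply_projection_conj (H : Subgroup G)
    {Ψ : (basic π J (subgroupL H)).toStarSubalgebra →L[ℂ]
      (basic π J (subgroupL H)).toStarSubalgebra} (hnorm : ‖Ψ‖ ≤ 1)
    (hfix : ∀ a, Ψ (piMap hπ hJ H a) = piMap hπ hJ H a)
    (hrange : ∀ X, ∃ a, Ψ X = piMap hπ hJ H a)
    {φ : (basic π J (subgroupL H)).toStarSubalgebra →L[ℂ] ℂ}
    (hφ : ∀ a, φ (piMap hπ hJ H a) = (trace G).toFunctional a) (g : G)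
    (X : (basic π J (subgroupL H)).toStarSubalgebra) :
    φ (Ψ (piMap hπ hJ H (lam g) * X * star (piMap hπ hJ H (lam g)))) = φ (Ψ X) := by
  have hconj {c d : (L G).toStarSubalgebra} (hcd : c * d = 1)
      (X : (basic π J (subgroupL H)).toStarSubalgebra) :
      φ (piMap hπ hJ H d * Ψ X * piMap hπ hJ H c) = φ (Ψ X) := by
    obtain ⟨b, hb⟩ := hrange X
    rw [hb, piMap_mul, piMap_mul, hφ, hφ, (trace G).map_mul_comm, ← mul_assoc, hcd, one_mul]
  have hl : star (lam g) * lam g = 1 := by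
    rw [star_lam, lam_mul_lam, inv_mul_cancel, lam_one]
  have hr : lam g * star (lam g) = 1 := by
    rw [star_lam, lam_mul_lam, mul_inv_cancel, lam_one]
  have hS (X : (basic π J (subgroupL H)).toStarSubalgebra) :
      X ∈ π.range.comap (basic π J (subgroupL H)).toStarSubalgebra.subtype ↔ Ψ X = X := by
    constructor
    · rintro ⟨a, ha⟩
      have : X = piMap hπ hJ H a := Subtype.ext ha.symm
      rw [this, hfix]
    · intro h
      obtain ⟨a, ha⟩ := hrange X
      exact ⟨a, congrArg Subtype.val (ha.symm.trans h)⟩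
  refine CStarAlgebra.apply_map_conj hnorm
    (π.range.comap (basic π J (subgroupL H)).toStarSubalgebra.subtype) hS ⟨lam g, rfl⟩
    (piMap_lam_mem_unitary hπ hJ H g) φ (fun X => ?_) (fun X => ?_) X
  · rw [star_piMap]
    exact hconj hl X
  · rw [star_piMap]
    exact hconj hr X

include hπ hJ in
/-- A norm one projection of the basic construction onto `L(G)`, followed by the trace, restricts to
an invariant mean on the bounded functions on `G/H`. -/
theorem exists_isInvariantMean (H : Subgroup G)
    (Ψ : (basic π J (subgroupL H)).toStarSubalgebra →L[ℂ]
      (basic π J (subgroupL H)).toStarSubalgebra)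
    (hnorm : ‖Ψ‖ = 1) (hproj : Ψ.comp Ψ = Ψ)
    (hrange : Set.range (fun X => (Ψ X : 𝓗 →L[ℂ] 𝓗)) = Set.range π) :
    ∃ m : boundedInvariant H →ₗ[ℝ] ℝ, IsInvariantMean H m := by
  have hfix (a : (L G).toStarSubalgebra) : Ψ (piMap hπ hJ H a) = piMap hπ hJ H a := by
    obtain ⟨Y, hY⟩ : π a ∈ Set.range (fun X => (Ψ X : 𝓗 →L[ℂ] 𝓗)) := by
      rw [hrange]
      exact ⟨a, rfl⟩
    have hY' : Ψ Y = piMap hπ hJ H a := Subtype.ext hY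
    rw [← hY']
    exact congrArg (fun F => F Y) hproj
  have hrange' (X : (basic π J (subgroupL H)).toStarSubalgebra) :
      ∃ a, Ψ X = piMap hπ hJ H a := by
    obtain ⟨a, ha⟩ : (Ψ X : 𝓗 →L[ℂ] 𝓗) ∈ Set.range π := by
      rw [← hrange]
      exact ⟨X, rfl⟩
    exact ⟨a, Subtype.ext ha.symm⟩
  obtain ⟨φ, hφ, hφ_le⟩ := exists_extend_trace hπ hJ H
  let m : boundedInvariant H →ₗ[ℝ] ℝ :=
    { toFun := fun f => (φ (Ψ (diagMap hπ hJ H f))).re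
      map_add' := fun f f' => by simp
      map_smul' := fun c f => by
        rw [map_smul, ← Complex.coe_smul, map_smul, map_smul]
        simp }
  have hm (f : boundedInvariant H) : m f = (φ (Ψ (diagMap hπ hJ H f))).re := rfl
  refine ⟨m, ?_, ?_, ?_⟩
  · intro f C hf
    have hC : 0 ≤ C := (abs_nonneg _).trans (hf 1)
    refine (Complex.abs_re_le_norm _).trans ((hφ_le _).trans ?_)
    refine (Ψ.le_of_opNorm_le hnorm.le _).trans ?_
    rw [one_mul]
    change ‖(diagMap hπ hJ H f : 𝓗 →L[ℂ] 𝓗)‖ ≤ C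
    rw [coe_diagMap hπ hJ H f hC hf]
    exact norm_diag_le U hC hf
  · intro f hf
    have h1 : diagMap hπ hJ H f = piMap hπ hJ H 1 := by
      rw [piMap_one]
      refine Subtype.ext ?_
      ext1 ξ
      refine ext_of_map U fun x => ?_
      rw [map_diagMap_apply, hf]
      simp
    rw [hm, h1, hfix, hφ, (trace G).map_one, Complex.one_re]
  · intro g f f' hff'
    rw [hm, hm, ← piMap_lam_conj hπ hJ H g hff',
      apply_projection_conj hπ hJ H hnorm.le hfix hrange' hφ]

end StandardForm

end GroupVonNeumannAlgebra

/-! ### Invariant means and fixed points -/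

section Barycenter

variable {E : Type*} [AddCommGroup E] [Module ℝ E] [TopologicalSpace E]

/-- The continuous affine functions on a set `K`. -/
def continuousAffine (K : Set E) : Submodule ℝ (K → ℝ) where
  carrier := {a | Continuous a ∧ ∀ (x y z : K) (s t : ℝ), 0 ≤ s → 0 ≤ t → s + t = 1 →
    (z : E) = s • (x : E) + t • (y : E) → a z = s * a x + t * a y}
  add_mem' := by
    rintro a b ⟨ha, ha'⟩ ⟨hb, hb'⟩
    refine ⟨ha.add hb, fun x y z s t hs ht hst hz => ?_⟩
    rw [Pi.add_apply, Pi.add_apply, Pi.add_apply, ha' x y z s t hs ht hst hz,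
      hb' x y z s t hs ht hst hz]
    ring
  zero_mem' := ⟨continuous_const, by simp⟩
  smul_mem' := by
    rintro c a ⟨ha, ha'⟩
    refine ⟨ha.const_smul c, fun x y z s t hs ht hst hz => ?_⟩
    simp only [Pi.smul_apply, smul_eq_mul, ha' x y z s t hs ht hst hz]
    ring

/-- The existence of barycenters: a positive unital functional on the continuous affine functions on
a compact convex set is the evaluation at a point. By compactness only finitely many functions have
to be considered, and these are dealt with by separation in a finite dimensional space. -/
theorem exists_barycenter {K : Set E} (hconv : Convex ℝ K) (hcomp : IsCompact K)
    (μ : continuousAffine K →ₗ[ℝ] ℝ)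
    (hμ : ∀ (a : continuousAffine K) (C : ℝ), (∀ x, a.1 x ≤ C) → μ a ≤ C) :
    ∃ x : K, ∀ a : continuousAffine K, a.1 x = μ a := by
  have : CompactSpace K := isCompact_iff_compactSpace.1 hcomp
  have hclosed (a : continuousAffine K) : IsClosed {x : K | a.1 x = μ a} :=
    isClosed_eq a.2.1 continuous_const
  have hfin (F : Finset (continuousAffine K)) :
      (Set.univ ∩ ⋂ a ∈ F, {x : K | a.1 x = μ a}).Nonempty := by
    let ev : K → (F → ℝ) := fun x a => a.1.1 x
    have hev : Continuous ev := continuous_pi fun a => a.1.2.1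
    have hS : IsCompact (Set.range ev) := isCompact_range hev
    have hSconv : Convex ℝ (Set.range ev) := by
      rintro _ ⟨x, rfl⟩ _ ⟨y, rfl⟩ s t hs ht hst
      refine ⟨⟨s • (x : E) + t • (y : E), hconv x.2 y.2 hs ht hst⟩, ?_⟩
      ext a
      exact a.1.2.2 x y _ s t hs ht hst rfl
    by_cases hp : (fun a : F => μ a.1) ∈ Set.range ev
    · obtain ⟨x, hx⟩ := hp
      refine ⟨x, trivial, Set.mem_iInter₂.2 fun a ha => ?_⟩
      exact congrFun hx ⟨a, ha⟩
    · exfalso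
      classical
      obtain ⟨f, r, hf, hr⟩ := geometric_hahn_banach_closed_point hSconv hS.isClosed hp
      let c : continuousAffine K := ∑ a : F, f (Pi.single a 1) • a.1
      have hfs (y : F → ℝ) : f y = ∑ a : F, f (Pi.single a 1) * y a := by
        have := LinearMap.pi_apply_eq_sum_univ f.toLinearMap y
        simp only [ContinuousLinearMap.coe_coe, smul_eq_mul] at this
        rw [this]
        refine Finset.sum_congr rfl fun a _ => ?_
        rw [mul_comm]
        congr 2
        ext b
        simp [Pi.single_apply, eq_comm]
      have hc (x : K) : c.1 x = f (ev x) := by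
        rw [hfs]
        simp [c, ev]
      have h1 : μ c ≤ r := hμ c r fun x => by
        rw [hc]
        exact (hf _ ⟨x, rfl⟩).le
      have h2 : μ c = f (fun a : F => μ a.1) := by
        rw [hfs]
        simp [c]
      linarith
  obtain ⟨x, -, hx⟩ := isCompact_univ.inter_iInter_nonempty _ hclosed hfin
  exact ⟨x, fun a => Set.mem_iInter.1 hx a⟩

end Barycenter

namespace GroupVonNeumannAlgebra

variable {G : Type u} [Group G] {H : Subgroup G}

theorem IsInvariantMean.le {m : boundedInvariant H →ₗ[ℝ] ℝ} (hm : IsInvariantMean H m)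
    (f : boundedInvariant H) {C : ℝ} (hf : ∀ x, f.1 x ≤ C) : m f ≤ C := by
  obtain ⟨D, hD⟩ := f.2.1
  let e : boundedInvariant H := ⟨fun _ => 1, ⟨1, by simp⟩, by simp⟩
  -- The function `f` takes its values in `[-D, C]`, an interval with midpoint `(C - D) / 2`.
  have h1 := hm.abs_le (f - ((C - D) / 2) • e) ((C + D) / 2) fun x => by
    change |f.1 x - (C - D) / 2 * 1| ≤ _
    rw [_root_.abs_le]
    constructor <;> linarith [hf x, (_root_.abs_le.1 (hD x)).1]
  rw [map_sub, map_smul, hm.map_one e fun _ => rfl, smul_eq_mul] at h1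
  linarith [(_root_.abs_le.1 h1).2]

/-- If there is an invariant mean on `G/H`, then `H` is co-amenable in `G`: the barycenter of the
image of the mean under the orbit map of an `H`-fixed point is a `G`-fixed point. -/
theorem IsInvariantMean.isCoamenable {m : boundedInvariant H →ₗ[ℝ] ℝ}
    (hm : IsInvariantMean H m) : Subgroup.IsCoamenable.{u, v} H := by
  intro E _ _ _ _ _ _ _ K _ hconv hcomp hcont haff ⟨x₀, hx₀⟩
  have : CompactSpace K := isCompact_iff_compactSpace.1 hcomp
  let orb : continuousAffine K →ₗ[ℝ] boundedInvariant H :=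
    { toFun := fun a => ⟨fun g => a.1 (g • x₀), by
        obtain ⟨C, hC⟩ := (isCompact_range (a.2.1.abs)).bddAbove
        exact ⟨C, fun g => hC ⟨_, rfl⟩⟩, fun g h hh => by
          change a.1 ((g * h) • x₀) = a.1 (g • x₀)
          rw [mul_smul, hx₀ h hh]⟩
      map_add' := fun _ _ => rfl
      map_smul' := fun _ _ => rfl }
  obtain ⟨x, hx⟩ := exists_barycenter hconv hcomp (m ∘ₗ orb) fun a C hC =>
    hm.le _ fun g => hC (g • x₀)
  refine ⟨x, fun g => ?_⟩
  by_contra hne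
  obtain ⟨ℓ, hℓ⟩ := geometric_hahn_banach_point_point
    (x := ((g • x : K) : E)) (y := (x : E)) fun h => hne (Subtype.ext h)
  let a : continuousAffine K := ⟨fun y => ℓ y, ℓ.continuous.comp continuous_subtype_val,
    fun x y z s t _ _ _ hz => by simp [hz]⟩
  let b : continuousAffine K := ⟨fun y => ℓ (g • y : K),
    ℓ.continuous.comp (continuous_subtype_val.comp (hcont g)),
    fun x y z s t hs ht hst hz => by simp [haff g x y z s t hs ht hst hz]⟩
  have h1 : m (orb b) = m (orb a) := hm.map_translate g⁻¹ _ _ fun k => by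
    change ℓ (g • k • x₀ : K) = ℓ ((g⁻¹⁻¹ * k) • x₀ : K)
    rw [inv_inv, mul_smul]
  have h2 : ℓ (g • x : K) = m (orb b) := hx b
  have h3 : ℓ x = m (orb a) := hx a
  exact hℓ.ne (by rw [h2, h3, h1])

end GroupVonNeumannAlgebra

/-! ### Coefficients of contractions -/

namespace VonNeumannAlgebra

variable {𝓗 : Type u} [NormedAddCommGroup 𝓗] [InnerProductSpace ℂ 𝓗] [CompleteSpace 𝓗]

/-- For a set `S` of operators and a submodule `V` of operators, the predicate that `Φ` is the
family of matrix coefficients `(T, ξ, η) ↦ ⟨ξ, Ψ(T) η⟩` of a contractive linear map `Ψ` on `V`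
which fixes the operators in `V ∩ S`. -/
structure IsCoefficient (S : Set (𝓗 →L[ℂ] 𝓗)) (V : Submodule ℂ (𝓗 →L[ℂ] 𝓗))
    (Φ : ULift.{v} (V × 𝓗 × 𝓗) → ℂ) : Prop where
  norm_le : ∀ i, ‖Φ i‖ ≤ ‖i.down.1‖ * ‖i.down.2.1‖ * ‖i.down.2.2‖
  add₁ : ∀ T T' ξ η, Φ ⟨T + T', ξ, η⟩ = Φ ⟨T, ξ, η⟩ + Φ ⟨T', ξ, η⟩
  smul₁ : ∀ (c : ℂ) T ξ η, Φ ⟨c • T, ξ, η⟩ = c * Φ ⟨T, ξ, η⟩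
  add₂ : ∀ T ξ ξ' η, Φ ⟨T, ξ + ξ', η⟩ = Φ ⟨T, ξ, η⟩ + Φ ⟨T, ξ', η⟩
  smul₂ : ∀ (c : ℂ) T ξ η, Φ ⟨T, c • ξ, η⟩ = starRingEnd ℂ c * Φ ⟨T, ξ, η⟩
  add₃ : ∀ T ξ η η', Φ ⟨T, ξ, η + η'⟩ = Φ ⟨T, ξ, η⟩ + Φ ⟨T, ξ, η'⟩
  smul₃ : ∀ (c : ℂ) T ξ η, Φ ⟨T, ξ, c • η⟩ = c * Φ ⟨T, ξ, η⟩
  fix : ∀ (T : V) ξ η, (T : 𝓗 →L[ℂ] 𝓗) ∈ S → Φ ⟨T, ξ, η⟩ = ⟪ξ, (T : 𝓗 →L[ℂ] 𝓗) η⟫_ℂ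

variable {S : Set (𝓗 →L[ℂ] 𝓗)} {V : Submodule ℂ (𝓗 →L[ℂ] 𝓗)}

omit [CompleteSpace 𝓗] in
theorem convex_isCoefficient : Convex ℝ {Φ : ULift.{v} (V × 𝓗 × 𝓗) → ℂ | IsCoefficient S V Φ} := by
  intro Φ h Φ' h' s t hs ht hst
  have hap (i) : (s • Φ + t • Φ') i = (s : ℂ) * Φ i + t * Φ' i := by simp
  have hst' : (s : ℂ) + t = 1 := by exact_mod_cast hst
  refine ⟨fun i => ?_, ?_, ?_, ?_, ?_, ?_, ?_, ?_⟩
  · rw [hap]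
    refine (norm_add_le _ _).trans ?_
    rw [norm_mul, norm_mul, Complex.norm_of_nonneg hs, Complex.norm_of_nonneg ht]
    refine (add_le_add (mul_le_mul_of_nonneg_left (h.norm_le i) hs)
      (mul_le_mul_of_nonneg_left (h'.norm_le i) ht)).trans_eq ?_
    rw [← add_mul, hst, one_mul]
  · intro T T' ξ η
    rw [hap, hap, hap, h.add₁, h'.add₁]
    ring
  · intro c T ξ η
    rw [hap, hap, h.smul₁, h'.smul₁]
    ring
  · intro T ξ ξ' η
    rw [hap, hap, hap, h.add₂, h'.add₂]
    ring
  · intro c T ξ η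
    rw [hap, hap, h.smul₂, h'.smul₂]
    ring
  · intro T ξ η η'
    rw [hap, hap, hap, h.add₃, h'.add₃]
    ring
  · intro c T ξ η
    rw [hap, hap, h.smul₃, h'.smul₃]
    ring
  · intro T ξ η hT
    rw [hap, h.fix T ξ η hT, h'.fix T ξ η hT, ← add_mul, hst', one_mul]

omit [CompleteSpace 𝓗] in
theorem isCompact_isCoefficient :
    IsCompact {Φ : ULift.{v} (V × 𝓗 × 𝓗) → ℂ | IsCoefficient S V Φ} := by
  have hK : IsCompact (Set.univ.pi fun i : ULift.{v} (V × 𝓗 × 𝓗) =>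
      Metric.closedBall (0 : ℂ) (‖i.down.1‖ * ‖i.down.2.1‖ * ‖i.down.2.2‖)) :=
    isCompact_univ_pi fun i => isCompact_closedBall _ _
  refine hK.of_isClosed_subset ?_ fun Φ h i _ => by simpa using h.norm_le i
  have heq : {Φ : ULift.{v} (V × 𝓗 × 𝓗) → ℂ | IsCoefficient S V Φ} =
      {Φ | ∀ i, ‖Φ i‖ ≤ ‖i.down.1‖ * ‖i.down.2.1‖ * ‖i.down.2.2‖} ∩
      {Φ | ∀ T T' ξ η, Φ ⟨T + T', ξ, η⟩ = Φ ⟨T, ξ, η⟩ + Φ ⟨T', ξ, η⟩} ∩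
      {Φ | ∀ (c : ℂ) T ξ η, Φ ⟨c • T, ξ, η⟩ = c * Φ ⟨T, ξ, η⟩} ∩
      {Φ | ∀ T ξ ξ' η, Φ ⟨T, ξ + ξ', η⟩ = Φ ⟨T, ξ, η⟩ + Φ ⟨T, ξ', η⟩} ∩
      {Φ | ∀ (c : ℂ) T ξ η, Φ ⟨T, c • ξ, η⟩ = starRingEnd ℂ c * Φ ⟨T, ξ, η⟩} ∩
      {Φ | ∀ T ξ η η', Φ ⟨T, ξ, η + η'⟩ = Φ ⟨T, ξ, η⟩ + Φ ⟨T, ξ, η'⟩} ∩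
      {Φ | ∀ (c : ℂ) T ξ η, Φ ⟨T, ξ, c • η⟩ = c * Φ ⟨T, ξ, η⟩} ∩
      {Φ | ∀ (T : V) ξ η, (T : 𝓗 →L[ℂ] 𝓗) ∈ S →
        Φ ⟨T, ξ, η⟩ = ⟪ξ, (T : 𝓗 →L[ℂ] 𝓗) η⟫_ℂ} := by
    ext Φ
    constructor
    · rintro ⟨h1, h2, h3, h4, h5, h6, h7, h8⟩
      exact ⟨⟨⟨⟨⟨⟨⟨h1, h2⟩, h3⟩, h4⟩, h5⟩, h6⟩, h7⟩, h8⟩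
    · rintro ⟨⟨⟨⟨⟨⟨⟨h1, h2⟩, h3⟩, h4⟩, h5⟩, h6⟩, h7⟩, h8⟩
      exact ⟨h1, h2, h3, h4, h5, h6, h7, h8⟩
  rw [heq]
  simp only [Set.ofPred_forall]
  refine IsClosed.inter (IsClosed.inter (IsClosed.inter (IsClosed.inter (IsClosed.inter
    (IsClosed.inter (IsClosed.inter ?_ ?_) ?_) ?_) ?_) ?_) ?_) ?_ <;>
  repeat' refine isClosed_iInter fun _ => ?_
  · exact isClosed_le (by fun_prop) (by fun_prop)
  all_goals exact isClosed_eq (by fun_prop) (by fun_prop)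

/-- The contractive linear map with given matrix coefficients. -/
theorem IsCoefficient.exists_map {Φ : ULift.{v} (V × 𝓗 × 𝓗) → ℂ} (h : IsCoefficient S V Φ) :
    ∃ Ψ : V →L[ℂ] (𝓗 →L[ℂ] 𝓗), ‖Ψ‖ ≤ 1 ∧
      ∀ T ξ η, ⟪ξ, Ψ T η⟫_ℂ = Φ ⟨T, ξ, η⟩ := by
  let B (T : V) : 𝓗 →L⋆[ℂ] 𝓗 →L[ℂ] ℂ :=
    (LinearMap.mk₂'ₛₗ (starRingEnd ℂ) (RingHom.id ℂ) (fun ξ η => Φ ⟨T, ξ, η⟩)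
      (h.add₂ T) (fun c => h.smul₂ c T) (h.add₃ T) (fun c => h.smul₃ c T)).mkContinuous₂ ‖T‖
      fun ξ η => h.norm_le ⟨T, ξ, η⟩
  let P (T : V) : 𝓗 →L[ℂ] 𝓗 :=
    ContinuousLinearMap.adjoint (InnerProductSpace.continuousLinearMapOfBilin (B T))
  have hP (T : V) (ξ η : 𝓗) : ⟪ξ, P T η⟫_ℂ = Φ ⟨T, ξ, η⟩ := by
    rw [ContinuousLinearMap.adjoint_inner_right,
      InnerProductSpace.continuousLinearMapOfBilin_apply]
    rfl
  have hle (T : V) : ‖P T‖ ≤ 1 * ‖T‖ := by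
    rw [one_mul]
    refine ContinuousLinearMap.opNorm_le_bound _ (norm_nonneg _) fun η => ?_
    have h1 := h.norm_le ⟨T, P T η, η⟩
    rw [← hP, inner_self_eq_norm_sq_to_K, norm_pow] at h1
    simp only [RCLike.norm_ofReal, abs_norm] at h1
    rcases (norm_nonneg (P T η)).eq_or_lt with h0 | h0
    · rw [← h0]
      positivity
    · refine le_of_mul_le_mul_left ?_ h0
      nlinarith
  let Ψ : V →ₗ[ℂ] (𝓗 →L[ℂ] 𝓗) :=
    { toFun := P
      map_add' := fun T T' => by
        ext1 η
        refine ext_inner_left ℂ fun ξ => ?_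
        rw [add_apply, inner_add_right, hP, hP, hP, h.add₁]
      map_smul' := fun c T => by
        ext1 η
        refine ext_inner_left ℂ fun ξ => ?_
        rw [RingHom.id_apply, smul_apply, inner_smul_right, hP, hP, h.smul₁] }
  exact ⟨Ψ.mkContinuous 1 hle, Ψ.mkContinuous_norm_le zero_le_one _, hP⟩

end VonNeumannAlgebra

open VonNeumannAlgebra in
/-- Let `R` be a unitary representation of `G` and `V` a space of operators which commute with
`R(H)`. If `H` is co-amenable in `G`, then there is a contraction of `V` into the commutant of
`R(G)` which fixes the operators in `V` that commute with `R(G)`. It is a fixed point of the action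
of `G` by `Φ ↦ R(g) Φ(·) R(g)*` on the contractions of `V` with the latter property; the inclusion
map of `V` is fixed by `H`. -/
theorem Subgroup.IsCoamenable.exists_contraction {G : Type u} [Group G] {H : Subgroup G}
    (hH : Subgroup.IsCoamenable.{u, v} H)
    {𝓗 : Type u} [NormedAddCommGroup 𝓗] [InnerProductSpace ℂ 𝓗] [CompleteSpace 𝓗]
    {R : G → 𝓗 → 𝓗} (hadd : ∀ g ξ η, R g (ξ + η) = R g ξ + R g η)
    (hsmul : ∀ g (c : ℂ) ξ, R g (c • ξ) = c • R g ξ)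
    (hinner : ∀ g ξ η, ⟪R g ξ, R g η⟫_ℂ = ⟪ξ, η⟫_ℂ)
    (hone : ∀ ξ, R 1 ξ = ξ) (hmul : ∀ g k ξ, R (g * k) ξ = R g (R k ξ))
    (V : Submodule ℂ (𝓗 →L[ℂ] 𝓗)) (hV : ∀ T ∈ V, ∀ h ∈ H, ∀ ξ, T (R h ξ) = R h (T ξ)) :
    ∃ Ψ : V →L[ℂ] (𝓗 →L[ℂ] 𝓗), ‖Ψ‖ ≤ 1 ∧ (∀ T g ξ, Ψ T (R g ξ) = R g (Ψ T ξ)) ∧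
      ∀ T : V, (∀ g ξ, (T : 𝓗 →L[ℂ] 𝓗) (R g ξ) = R g ((T : 𝓗 →L[ℂ] 𝓗) ξ)) →
        Ψ T = (T : 𝓗 →L[ℂ] 𝓗) := by
  have hnorm (g : G) (ξ : 𝓗) : ‖R g ξ‖ = ‖ξ‖ := by
    rw [norm_eq_sqrt_re_inner (𝕜 := ℂ), hinner, ← norm_eq_sqrt_re_inner]
  let S : Set (𝓗 →L[ℂ] 𝓗) := {T | ∀ g ξ, T (R g ξ) = R g (T ξ)}
  let K : Set (ULift.{v} (V × 𝓗 × 𝓗) → ℂ) := {Φ | IsCoefficient S V Φ}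
  let tr (g : G) (Φ : ULift.{v} (V × 𝓗 × 𝓗) → ℂ) : ULift.{v} (V × 𝓗 × 𝓗) → ℂ :=
    fun i => Φ ⟨i.down.1, R g⁻¹ i.down.2.1, R g⁻¹ i.down.2.2⟩
  have htr (g : G) (Φ : ULift.{v} (V × 𝓗 × 𝓗) → ℂ) (hΦ : Φ ∈ K) : tr g Φ ∈ K := by
    refine ⟨fun i => ?_, fun T T' ξ η => hΦ.add₁ _ _ _ _, fun c T ξ η => hΦ.smul₁ _ _ _ _,
      fun T ξ ξ' η => ?_, fun c T ξ η => ?_, fun T ξ η η' => ?_, fun c T ξ η => ?_,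
      fun T ξ η hT => ?_⟩
    · refine (hΦ.norm_le _).trans_eq ?_
      simp only [hnorm]
    · simp only [tr, hadd, hΦ.add₂]
    · simp only [tr, hsmul, hΦ.smul₂]
    · simp only [tr, hadd, hΦ.add₃]
    · simp only [tr, hsmul, hΦ.smul₃]
    · simp only [tr]
      rw [hΦ.fix T _ _ hT, hT, hinner]
  let _ : MulAction G K :=
    { smul := fun g Φ => ⟨tr g Φ, htr g Φ Φ.2⟩
      one_smul := fun Φ => Subtype.ext <| funext fun i => by
        change Φ.1 ⟨i.down.1, R 1⁻¹ i.down.2.1, R 1⁻¹ i.down.2.2⟩ = Φ.1 i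
        rw [inv_one, hone, hone]
      mul_smul := fun g k Φ => Subtype.ext <| funext fun i => by
        change Φ.1 ⟨i.down.1, R (g * k)⁻¹ i.down.2.1, R (g * k)⁻¹ i.down.2.2⟩ =
          Φ.1 ⟨i.down.1, R k⁻¹ (R g⁻¹ i.down.2.1), R k⁻¹ (R g⁻¹ i.down.2.2)⟩
        rw [mul_inv_rev, hmul, hmul] }
  have hact (g : G) (Φ : K) (T : V) (ξ η : 𝓗) :
      (g • Φ : K).1 ⟨T, ξ, η⟩ = Φ.1 ⟨T, R g⁻¹ ξ, R g⁻¹ η⟩ := rfl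
  obtain ⟨Φ, hΦ⟩ := hH (ULift.{v} (V × 𝓗 × 𝓗) → ℂ) K convex_isCoefficient
    isCompact_isCoefficient
    (fun g => by
      refine Continuous.subtype_mk (f := fun Φ : K => tr g Φ) ?_ _
      refine continuous_pi fun i => ?_
      exact (continuous_apply (⟨i.down.1, R g⁻¹ i.down.2.1, R g⁻¹ i.down.2.2⟩ :
        ULift.{v} (V × 𝓗 × 𝓗))).comp continuous_subtype_val)
    (fun g x y z a b _ _ _ hz => by
      ext i
      exact congrFun hz _)
    (by
      refine ⟨⟨fun i => ⟪i.down.2.1, (i.down.1 : 𝓗 →L[ℂ] 𝓗) i.down.2.2⟫_ℂ, ⟨fun i => ?_,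
        fun T T' ξ η => ?_, fun c T ξ η => ?_, fun T ξ ξ' η => ?_, fun c T ξ η => ?_,
        fun T ξ η η' => ?_, fun c T ξ η => ?_, fun T ξ η _ => rfl⟩⟩, fun h hh => ?_⟩
      · refine (norm_inner_le_norm _ _).trans ?_
        rw [mul_comm ‖i.down.1‖, mul_assoc]
        exact mul_le_mul_of_nonneg_left ((i.down.1 : 𝓗 →L[ℂ] 𝓗).le_opNorm _) (norm_nonneg _)
      · simp
      · simp
      · simp
      · simp [mul_comm]
      · simp
      · simp
      · refine Subtype.ext (funext fun i => ?_)
        change ⟪R h⁻¹ i.down.2.1, (i.down.1 : 𝓗 →L[ℂ] 𝓗) (R h⁻¹ i.down.2.2)⟫_ℂ = _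
        rw [hV _ i.down.1.2 _ (inv_mem hh), hinner])
  obtain ⟨Ψ, hΨ, hΨΦ⟩ := IsCoefficient.exists_map Φ.2
  refine ⟨Ψ, hΨ, fun T g ξ => ?_, fun T hT => ?_⟩
  · refine ext_inner_left ℂ fun η => ?_
    have h1 : R g (R g⁻¹ η) = η := by rw [← hmul, mul_inv_cancel, hone]
    have h2 : R g⁻¹ (R g ξ) = ξ := by rw [← hmul, inv_mul_cancel, hone]
    rw [hΨΦ, ← hΦ g, hact, h2, ← hΨΦ, ← hinner g, h1]
  · ext1 η
    refine ext_inner_left ℂ fun ξ => ?_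
    rw [hΨΦ, Φ.2.fix T ξ η hT]

/-! ### The norm one projection of a co-amenable subgroup -/

namespace GroupVonNeumannAlgebra

variable {G : Type u} [Group G]

theorem inner_rightReg (g : G) (f f' : ℓ²(G, ℂ)) :
    ⟪rightReg g f, rightReg g f'⟫_ℂ = ⟪f, f'⟫_ℂ := by
  rw [lp.inner_eq_tsum, lp.inner_eq_tsum]
  exact (Equiv.mulRight g).tsum_eq fun x => ⟪f x, f' x⟫_ℂ

/-- If `H` is co-amenable in `G`, there is a norm one projection of the basic construction onto
`L(G)`. -/
theorem exists_norm_one_projection {H : Subgroup G} (hH : Subgroup.IsCoamenable.{u, v} H)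
    {𝓗 : Type u} [NormedAddCommGroup 𝓗] [InnerProductSpace ℂ 𝓗] [CompleteSpace 𝓗]
    {U : 𝓗 ≃ₗᵢ[ℂ] ℓ²(G, ℂ)} {π : (L G).toStarSubalgebra →⋆ₐ[ℂ] (𝓗 →L[ℂ] 𝓗)}
    {J : 𝓗 →L⋆[ℂ] 𝓗} (hπ : ∀ a ξ, U (π a ξ) = (a : ℓ²(G, ℂ) →L[ℂ] ℓ²(G, ℂ)) (U ξ))
    (hJ : ∀ ξ, U (J ξ) = conjInv (U ξ)) :
    ∃ Ψ : (basic π J (subgroupL H)).toStarSubalgebra →L[ℂ]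
        (basic π J (subgroupL H)).toStarSubalgebra,
      ‖Ψ‖ = 1 ∧ Ψ.comp Ψ = Ψ ∧
        Set.range (fun X => (Ψ X : 𝓗 →L[ℂ] 𝓗)) = Set.range π := by
  let R (g : G) : 𝓗 →L[ℂ] 𝓗 := J.comp ((π (lam g)).comp J)
  have hR (g : G) (ξ : 𝓗) : U (R g ξ) = rightReg g (U ξ) := by
    ext x
    change U (J (π (lam g) (J ξ))) x = _
    rw [hJ, conjInv_apply, map_pi_lam_apply hπ, hJ, conjInv_apply, rightReg_apply]
    simp
  obtain ⟨Ψ, hΨ, hΨR, hfix⟩ := hH.exists_contraction (R := fun g => R g)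
    (fun g => map_add (R g)) (fun g => map_smul (R g))
    (fun g ξ η => by rw [← U.inner_map_map, hR, hR, inner_rightReg, U.inner_map_map])
    (fun ξ => ext_of_map U fun x => by rw [hR, rightReg_apply, mul_one])
    (fun g k ξ => ext_of_map U fun x => by
      rw [hR, hR, hR, rightReg_apply, rightReg_apply, rightReg_apply, mul_assoc])
    (basic π J (subgroupL H)).toStarSubalgebra.toSubalgebra.toSubmodule
    (fun T hT h hh ξ => by
      have h1 : leftReg h ∈ subgroupL H :=
        VonNeumannAlgebra.subset_generatedBy _ ⟨h, hh, rfl⟩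
      have h2 := ((VonNeumannAlgebra.mem_commutantOf.1 hT) (R h) ⟨lam h, h1, rfl⟩).1
      exact congrArg (fun F : 𝓗 →L[ℂ] 𝓗 => F ξ) h2.symm)
  have hmem (T) : Ψ T ∈ Set.range π := mem_range_pi hπ hJ (hΨR T)
  have hbasic (T) : Ψ T ∈ (basic π J (subgroupL H)).toStarSubalgebra := by
    obtain ⟨a, ha⟩ := hmem T
    rw [← ha]
    exact pi_mem hπ hJ H a
  have hfix' (a : (L G).toStarSubalgebra) : Ψ (piMap hπ hJ H a) = π a :=
    hfix (piMap hπ hJ H a) fun g ξ =>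
      congrArg (fun F : 𝓗 →L[ℂ] 𝓗 => F ξ) (pi_commute_conj_pi_conj hπ hJ a (lam g)).symm
  let P : (basic π J (subgroupL H)).toStarSubalgebra →L[ℂ]
      (basic π J (subgroupL H)).toStarSubalgebra :=
    LinearMap.mkContinuous
      { toFun := fun T => ⟨Ψ T, hbasic T⟩
        map_add' := fun T T' => Subtype.ext (map_add Ψ T T')
        map_smul' := fun c T => Subtype.ext (map_smul Ψ c T) }
      1 fun T => Ψ.le_of_opNorm_le hΨ T
  have hP (a : (L G).toStarSubalgebra) : P (piMap hπ hJ H a) = piMap hπ hJ H a :=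
    Subtype.ext (hfix' a)
  have hP' (T : (basic π J (subgroupL H)).toStarSubalgebra) :
      ∃ a, P T = piMap hπ hJ H a := by
    obtain ⟨a, ha⟩ := hmem T
    exact ⟨a, Subtype.ext ha.symm⟩
  refine ⟨P, le_antisymm (LinearMap.mkContinuous_norm_le _ zero_le_one _) ?_, ?_, ?_⟩
  · have : Nontrivial 𝓗 := by
      refine ⟨U.symm (delta 1), 0, fun h => ?_⟩
      have h1 : delta (1 : G) = 0 := by simpa using h
      have h2 : (delta (1 : G)) 1 = 0 := by rw [h1]; rfl
      simp [delta] at h2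
    have h1 : ‖(1 : (basic π J (subgroupL H)).toStarSubalgebra)‖ = 1 :=
      norm_one (α := 𝓗 →L[ℂ] 𝓗)
    have h2 := P.le_opNorm 1
    rwa [← piMap_one hπ hJ, hP, piMap_one, h1, mul_one] at h2
  · ext1 T
    obtain ⟨a, ha⟩ := hP' T
    rw [ContinuousLinearMap.comp_apply, ha, hP]
  · ext T
    constructor
    · rintro ⟨X, rfl⟩
      exact hmem X
    · rintro ⟨a, rfl⟩
      exact ⟨piMap hπ hJ H a, congrArg Subtype.val (hP a)⟩

end GroupVonNeumannAlgebra

theorem mainTheorem4 {G : Type u} [Group G] (H : Subgroup G) :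
    (GroupVonNeumannAlgebra.trace G).IsCoamenable (GroupVonNeumannAlgebra.subgroupL H)
        (GroupVonNeumannAlgebra.subgroupL_le H) ↔
      Subgroup.IsCoamenable.{u, v} H := by
  obtain ⟨U, hπ, hJ⟩ := GroupVonNeumannAlgebra.exists_l2Equiv G
  constructor
  · rintro ⟨Ψ, hnorm, hproj, hrange⟩
    obtain ⟨m, hm⟩ :=
      GroupVonNeumannAlgebra.exists_isInvariantMean hπ hJ H Ψ hnorm hproj hrange
    exact hm.isCoamenable
  · intro hH
    exact GroupVonNeumannAlgebra.exists_norm_one_projection hH hπ hJ
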